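/- **Language.** Consider a call-by-value ML core with expressions $e ::= v \mid (e,e) \mid e\,e \mid \mathsf{let}\,x=e\,\mathsf{in}\,e \mid \mathsf{if}\,e\,\mathsf{then}\,e\,\mathsf{else}\,e \mid \mathsf{spawn}\,e \mid \mathsf{match}\,e\,\{L_i:e_i\}_{i\in I}$ ($I$ finite) and values $v ::= x \mid () \mid \text{booleans} \mid \text{integers} \mid (v,v) \mid \mathsf{fun}\,x.e \mid \mathsf{rec}\,f(x).e \mid p^l$ together with the primitives $\mathsf{request}^l_c, \mathsf{accept}^l_c, \mathsf{send}, \mathsf{recv}, \mathsf{deleg}, \mathsf{resume}^l, \mathsf{select}_{L_i}$. Here $p$ ranges over a countably infinite set of endpoints with an involution $\bar p\neq p$, $l$ over region labels and $c$ over channels. A system is a multiset of closed expressions (processes). With $E$ ranging over left-to-right call-by-value evaluation contexts, *internal steps* are beta reductions ($\mathsf{if}$, $\mathsf{let}$, application of $\mathsf{fun}$ and $\mathsf{rec}$) inside some $E$, and $E[\mathsf{spawn}\,v]\parallel S\to E[()]\parallel v\,()\parallel S$. *Communication steps* are $$\begin{aligned} E_1[\mathsf{request}^{l_1}_c()]\parallel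 E_2[\mathsf{accept}^{l_2}_c()]\parallel S&\to E_1[p^{l_1}]\parallel E_2[\bar p^{\,l_2}]\parallel S\quad(p,\bar p\text{ fresh}),\\ E_1[\mathsf{send}(p^{l_1},v)]\parallel E_2[\mathsf{recv}\,\bar p^{\,l_2}]\parallel S&\to E_1[()]\parallel E_2[v]\parallel S,\\ E_1[\mathsf{deleg}(p^{l_1},q^{l_1'})]\parallel E_2[\mathsf{resume}^{l}\,\bar p^{\,l_2}]\parallel S&\to E_1[()]\parallel E_2[q^{l}]\parallel S,\\ E_1[\mathsf{select}_{L_j}p^{l_1}]\parallel E_2[\mathsf{match}\,\bar p^{\,l_2}\{L_i:e_i\}_{i\in I}]\parallel S&\to E_1[()]\parallel E_2[e_j]\parallel S\quad(j\in I). \end{aligned}$$ **Types.** Types are $T::=\mathsf{Unit}\mid\mathsf{Bool}\mid\mathsf{Int}\mid T\times T\mid T\xrightarrow{\beta}T\mid \mathsf{Ses}^{\rho}\mid\alpha$. Finite session types are $\eta::=\mathsf{end}\mid{!T}.\eta\mid{?T}.\eta\mid{!\eta}.\eta\mid{?\eta}.\eta\mid\bigoplus_{i\in I}{!L_i}.\eta_i\mid\sum_{i\in(I_1,I_2)}{?L_i}.\eta_i\mid\psi$,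 with $I_1\ne\emptyset$ (active labels) and $I_2$ (inactive labels) disjoint. Behaviours are $b::=\beta\mid\tau\mid b;b\mid b\oplus b\mid\mathsf{rec}_\beta b\mid\mathsf{spawn}\,b\mid\mathsf{push}(l{:}\eta)\mid\rho!T\mid\rho?T\mid\rho!\rho'\mid\rho?l\mid\rho!L_i\mid\&_{i\in I}\{\rho?L_i;b_i\}$. A constraint environment $C$ is a finite set of constraints $T\subseteq T'$, $b\subseteq\beta$, $\rho\sim l$, $\rho\sim\rho'$, $c\sim\eta$, $\bar c\sim\eta$, $\eta\bowtie\eta'$ and confinement constraints on types and behaviours. $C\vdash\cdot\sim\cdot$ on regions is the generated equivalence. $C\vdash b\subseteq b'$ is the reflexive transitive closure of the inclusions in $C$. $C\vdash T\subseteq T'$ is the least reflexive transitive relation that contains the inclusions in $C$, is covariant in pairs and function results and effects, contravariant in function arguments, and contains $\mathsf{Ses}^\rho\subseteq\mathsf{Ses}^{\rho'}$ whenever $C\vdash\rho\sim\rho'$. $C\vdash\eta<:\eta'$ is Gay–Hole session subtyping, where between external choices $(I_1,I_2)$ and $(J_1,J_2)$ one requires $I_1\subseteq J_1$, $J_1\cup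 J_2\subseteq I_1\cup I_2$ and subtyping of the branches in $J_1\cup J_2$. Duality $C\vdash\eta\bowtie\eta'$ is the least symmetric relation with $\mathsf{end}\bowtie\mathsf{end}$; ${!T}.\eta\bowtie{?T'}.\eta'$ if $T\subseteq T'$ and $\eta\bowtie\eta'$; ${!\eta_0}.\eta\bowtie{?\eta_0'}.\eta'$ if $\eta_0<:\eta_0'$ and $\eta\bowtie\eta'$; and $\bigoplus_{I}\bowtie\sum_{(J_1,J_2)}$ if $I\subseteq J_1$ and the branches in $I$ are dual. Confinement of types and behaviours is the least predicate that contains the base types, $\tau$, all $\mathsf{rec}_\beta b$ and the confinement constraints in $C$, that holds of a pair, function, $\oplus$, $;$ or $\mathsf{spawn}$ exactly when it holds of its components (for a function type, of argument, result and effect), and that is inherited by subtypes and sub-behaviours. The judgement $C;\Gamma\vdash e:\forall(\vec\gamma{:}C_0).T\triangleright b$ is the Hindley–Milner type-and-effect system with constrained schemas. Effects are composed sequentially in evaluation order. Conditionals give $b_1;(b_2\oplus b_3)$, applications $b_1;b_2;\beta$ with $\beta$ the latent effect, $\mathsf{spawn}\,e$ gives $b;\mathsf{spawn}\,\beta$ for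 $e:\mathsf{Unit}\xrightarrow{\beta}\mathsf{Unit}$, and $\mathsf{match}$ on $\mathsf{Ses}^\rho$ gives $b;\&_{i\in I}\{\rho?L_i;b_i\}$. Values have effect $\tau$. $p^l:\mathsf{Ses}^\rho$ if $C\vdash\rho\sim l$. $\mathsf{rec}\,f(x).e:T\xrightarrow{\beta}T'$ requires that $T,T'$ are confined, $C\vdash\mathsf{rec}_\beta b\subseteq\beta$, and that the body has type $T'$ and effect $b$. Subsumption changes $T\triangleright b$ to $T'\triangleright\beta$ when $C\vdash T\subseteq T'$ and $C\vdash b\subseteq\beta$. A schema may be instantiated by $\sigma$ with domain in $\vec\gamma$ and $C\vdash C_0\sigma$; generalisation from a typing under $C\cup C_0$ requires that $\vec\gamma$ is not free in $\Gamma,C,b$, that $\mathrm{fv}(C_0)\subseteq\vec\gamma$, and that some such $\sigma$ exists. The primitives have the schemas (with quantified variables generalised) $\mathsf{request}^l_c:\mathsf{Unit}\xrightarrow{\beta}\mathsf{Ses}^\rho$ with $\mathsf{push}(l{:}\psi)\subseteq\beta,\rho\sim l,c\sim\psi$ (for $\mathsf{accept}^l_c$: $\bar c\sim\psi$); $\mathsf{send}:\mathsf{Ses}^\rho\times\alpha\xrightarrow{\beta}\mathsf{Unit}$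 with $\rho!\alpha\subseteq\beta$, $\alpha$ confined; $\mathsf{recv}:\mathsf{Ses}^\rho\xrightarrow{\beta}\alpha$ with $\rho?\alpha\subseteq\beta$, $\alpha$ confined; $\mathsf{deleg}:\mathsf{Ses}^\rho\times\mathsf{Ses}^{\rho'}\xrightarrow{\beta}\mathsf{Unit}$ with $\rho!\rho'\subseteq\beta$; $\mathsf{resume}^l:\mathsf{Ses}^\rho\xrightarrow{\beta}\mathsf{Ses}^{\rho'}$ with $\rho?l\subseteq\beta,\rho'\sim l$; $\mathsf{select}_{L}:\mathsf{Ses}^\rho\xrightarrow{\beta}\mathsf{Unit}$ with $\rho!L\subseteq\beta$. **Abstract interpretation.** A stack $\Delta$ is a list of frames $(l:\eta)$, top first, which also records all labels that have been on it. The transitions $\Delta\vDash b\to_C\Delta'\vDash b'$ are: remove a top frame $(l:\mathsf{end})$, leaving $b$ unchanged; $\beta\to b$ if $C\vdash b\subseteq\beta$; $b_1\oplus b_2\to b_i$; $\mathsf{push}(l{:}\eta)\to\tau$, pushing $(l:\eta)$ if $l$ has never been on the stack. When the top frame has label $l$ and $C\vdash\rho\sim l$: $\rho!T'\to\tau$ changes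 its type ${!T}.\eta$ to $\eta$ if $C\vdash T'\subseteq T$; $\rho?T'\to\tau$ changes ${?T}.\eta$ to $\eta$ if $C\vdash T\subseteq T'$; $\rho!\rho_d\to\tau$ changes ${!\eta_d}.\eta$ to $\eta$ and removes the second frame $(l_d:\eta_d')$ if $C\vdash\rho_d\sim l_d$ and $C\vdash\eta_d'<:\eta_d$; if this is the only frame and $l_r\ne l$, $\rho?l_r\to\tau$ changes ${?\eta_r}.\eta$ to $\eta$ and inserts $(l_r:\eta_r)$ below it; $\rho!L_j\to\tau$ changes $\bigoplus_I{!L_i}.\eta_i$ to $\eta_j$ for $j\in I$; and $\&_{J}\{\rho?L_j;b_j\}\to b_k$, for $k\in J$, changes $\sum_{(I_1,I_2)}{?L_i}.\eta_i$ to $\eta_k$ if $I_1\subseteq J\subseteq I_1\cup I_2$. Finally $\mathsf{rec}_\beta b\to\tau$ if $\varepsilon\vDash b\Downarrow_{C'}$, where $C'$ is $C$ with all inclusions in $\beta$ replaced by $\tau\subseteq\beta$; $\mathsf{spawn}\,b\to\tau$ if $\varepsilon\vDash b\Downarrow_C$; $b_1;b_2$ steps as $b_1$ does; and $\tau;b\to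 b$. Here $\Delta\vDash b\Downarrow_C$ means that every reachable configuration without transitions is $\varepsilon\vDash\tau$. $C$ is *well-formed* if: (1) whenever $C\vdash T\subseteq T'$ for non-variable types, $T,T'$ have the same head constructor and their components are correspondingly related by $C\vdash$ (contravariantly in function arguments); (2) $C\vdash l\sim l'$ implies $l=l'$; (3) every cycle of behaviour inclusions contains some $\mathsf{rec}_\beta b\subseteq\beta$, and if $(\mathsf{rec}_\beta b\subseteq\beta')\in C$ then $\beta=\beta'$ and it is the only inclusion in $\beta$; (4) no type $\mathsf{Ses}^\rho$ and no session operation ($\rho!T,\rho?T,\rho!\rho',\rho?l,\rho!L_i,\&_{i\in I}\{\rho?L_i;b_i\}$) is confined. $C$ is *valid* if for some substitution $\sigma$ of closed session types for session variables, $C\sigma$ is well-formed and $C\vdash\eta\bowtie\eta'$ for all $(c\sim\eta),(\bar c\sim\eta')\in C\sigma$. **Running systems.** A running system $\mathcal S$ is a multiset of triples $(\Delta\vDash b,e)$ whose stack frames $(p^l:\eta)$ also carry endpoints. It makes a step to another running system if the underlying systems of expressions do. - $\mathcal S$ is *well-typed* under $C$ if $C$ is well-formed and valid and each $(\Delta\vDash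 b,e)\in\mathcal S$ has $C;\emptyset\vdash e:T\triangleright b$ for some $T$, and $\Delta\vDash b\Downarrow_C$. - $\mathcal S$ is *well-stacked* under $C$ if all stacks can be emptied by repeatedly removing frames $(p^l:\eta)$, $(\bar p^{\,l'}:\eta')$ with $C\vdash\eta\bowtie\eta'$ from the tops of the stacks of two distinct processes, $p,\bar p$ not occurring in the remaining stacks. - $\mathcal S$ is *well-annotated* if, for each $(\Delta\vDash b,e)\in\mathcal S$, whenever $(p^l:\eta)$ is a frame of $\Delta$ and $q^l$ occurs in $e$, then $q=p$. A process $(\Delta\vDash b,e)$ is *finished* if $\Delta=\varepsilon$, $b=\tau$ and $e$ is a value; *diverging* if it has an infinite sequence of internal steps; *waiting* if $e=E[\mathsf{request}^l_c()]$ or $e=E[\mathsf{accept}^l_c()]$; *blocked* if $e=E[e_0]$ where $e_0$ is $\mathsf{send}\,v$, $\mathsf{recv}\,v$, $\mathsf{deleg}\,v$, $\mathsf{resume}^l\,v$, $\mathsf{select}_L\,v$ or $\mathsf{match}\,v\,\{L_i:e_i\}_{i\in I}$. Write $(\mathcal F,\mathcal D,\mathcal W,\mathcal B)$ for a running system made up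 of finished processes $\mathcal F$, diverging processes $\mathcal D$, waiting processes $\mathcal W$ and blocked processes $\mathcal B$. **Corollary (Partial Lock Freedom).** Let $\mathcal S$ be well-typed and well-stacked under $C$, and well-annotated. Suppose that no communication step is possible from $\mathcal S$, even after finitely many internal steps, and that $\mathcal S$ reduces by finitely many internal steps to $(\mathcal F,\emptyset,\emptyset,\mathcal B)$. Then $\mathcal B=\emptyset$. -/

import Mathlib

namespace MLS

/-! ### Types, session types, behaviours, constraints

Type, behaviour, region and session variables, region labels, global channels, choice labels and
program variables all range over countably infinite sets, represented by `ℕ`. The choice label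
`L_i` is represented by its index `i`. -/

/-- Types. The behaviour annotation of a function type is a behaviour variable, and the region
annotation of an endpoint type is a region variable. -/
inductive Ty : Type
  | var (α : ℕ)
  | unit
  | bool
  | int
  | pair (T₁ T₂ : Ty)
  | fn (T₁ : Ty) (β : ℕ) (T₂ : Ty)
  | ses (ρ : ℕ)

/-- Session types. `out`/`inp` exchange a value, `del`/`res` exchange an endpoint, `ich` is the
internal choice over a finite set of labels, and `ech` is the external choice with active labels
`I₁` and inactive labels `I₂`. -/
inductive Sess : Type
  | done
  | out (T : Ty) (η : Sess)
  | inp (T : Ty) (η : Sess)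
  | del (η₀ η : Sess)
  | res (η₀ η : Sess)
  | ich (I : Finset ℕ) (η : {i // i ∈ I} → Sess)
  | ech (I₁ I₂ : Finset ℕ) (hd : Disjoint I₁ I₂) (hn : I₁.Nonempty)
      (η : {i // i ∈ I₁ ∪ I₂} → Sess)
  | var (ψ : ℕ)

/-- Behaviours. `recur b β` is the recursive behaviour `rec_β b`; `push l η` opens a session of
type `η` at label `l`; `out`, `inp`, `del`, `res`, `sel`, `offer` are the operations
`ρ!T`, `ρ?T`, `ρ!ρ'`, `ρ?l`, `ρ!L_i` and `&_{i ∈ I} ρ?L_i; b_i`. -/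
inductive Beh : Type
  | var (β : ℕ)
  | tau
  | seq (b₁ b₂ : Beh)
  | plus (b₁ b₂ : Beh)
  | recur (b : Beh) (β : ℕ)
  | spawn (b : Beh)
  | push (l : ℕ) (η : Sess)
  | out (ρ : ℕ) (T : Ty)
  | inp (ρ : ℕ) (T : Ty)
  | del (ρ ρ' : ℕ)
  | res (ρ : ℕ) (l : ℕ)
  | sel (ρ : ℕ) (i : ℕ)
  | offer (ρ : ℕ) (I : Finset ℕ) (b : {i // i ∈ I} → Beh)

/-- Regions: labels (constants) and region variables. -/
inductive Region : Type
  | lab (l : ℕ)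
  | var (ρ : ℕ)

/-- Constraints. In order: `T ⊆ T'`, `cfd T`, `cfd b`, `b ⊆ β`, `ρ ∼ r`, `c ∼ η`
(request side of channel `c`), `c̄ ∼ η` (accept side of `c`), and `η ⋈ η'`. -/
inductive Constraint : Type
  | tySub (T T' : Ty)
  | cfdTy (T : Ty)
  | cfdBeh (b : Beh)
  | behSub (b : Beh) (β : ℕ)
  | region (ρ : ℕ) (r : Region)
  | reqChan (c : ℕ) (η : Sess)
  | accChan (c : ℕ) (η : Sess)
  | dual (η η' : Sess)

/-- A constraint environment: a finite collection of constraints (only membership matters). -/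
abbrev Constraints := List Constraint

/-- Variables of the four kinds. -/
inductive Var : Type
  | ty (α : ℕ)
  | beh (β : ℕ)
  | reg (ρ : ℕ)
  | ses (ψ : ℕ)

/-- Type schemas `∀ (γ : C₀). T`. -/
structure Scheme : Type where
  vars : List Var
  constr : Constraints
  body : Ty

/-- A type seen as a schema without quantified variables and constraints. -/
def Scheme.mono (T : Ty) : Scheme := ⟨[], [], T⟩

/-! ### Free variables -/

def Ty.fv : Ty → Set Var
  | .var α => {Var.ty α}
  | .unit => ∅
  | .bool => ∅
  | .int => ∅
  | .pair T₁ T₂ => T₁.fv ∪ T₂.fv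
  | .fn T₁ β T₂ => T₁.fv ∪ {Var.beh β} ∪ T₂.fv
  | .ses ρ => {Var.reg ρ}

def Sess.fv : Sess → Set Var
  | .done => ∅
  | .out T η => T.fv ∪ η.fv
  | .inp T η => T.fv ∪ η.fv
  | .del η₀ η => η₀.fv ∪ η.fv
  | .res η₀ η => η₀.fv ∪ η.fv
  | .ich _ η => ⋃ i, (η i).fv
  | .ech _ _ _ _ η => ⋃ i, (η i).fv
  | .var ψ => {Var.ses ψ}

def Beh.fv : Beh → Set Var
  | .var β => {Var.beh β}
  | .tau => ∅
  | .seq b₁ b₂ => b₁.fv ∪ b₂.fv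
  | .plus b₁ b₂ => b₁.fv ∪ b₂.fv
  | .recur b β => b.fv ∪ {Var.beh β}
  | .spawn b => b.fv
  | .push _ η => η.fv
  | .out ρ T => {Var.reg ρ} ∪ T.fv
  | .inp ρ T => {Var.reg ρ} ∪ T.fv
  | .del ρ ρ' => {Var.reg ρ, Var.reg ρ'}
  | .res ρ _ => {Var.reg ρ}
  | .sel ρ _ => {Var.reg ρ}
  | .offer ρ _ b => {Var.reg ρ} ∪ ⋃ i, (b i).fv

def Region.fv : Region → Set Var
  | .lab _ => ∅
  | .var ρ => {Var.reg ρ}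

def Constraint.fv : Constraint → Set Var
  | .tySub T T' => T.fv ∪ T'.fv
  | .cfdTy T => T.fv
  | .cfdBeh b => b.fv
  | .behSub b β => b.fv ∪ {Var.beh β}
  | .region ρ r => {Var.reg ρ} ∪ r.fv
  | .reqChan _ η => η.fv
  | .accChan _ η => η.fv
  | .dual η η' => η.fv ∪ η'.fv

def Constraints.fv (C : Constraints) : Set Var := {γ | ∃ c ∈ C, γ ∈ c.fv}

def Scheme.fv (S : Scheme) : Set Var :=
  (S.body.fv ∪ Constraints.fv S.constr) \ {γ | γ ∈ S.vars}

/-! ### Substitutions of type-level variables -/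

/-- Substitutions map type variables to types, behaviour variables to behaviour variables, region
variables to region variables, and session variables to session types. -/
structure Subst : Type where
  ty : ℕ → Ty
  beh : ℕ → ℕ
  reg : ℕ → ℕ
  ses : ℕ → Sess

def Ty.subst (σ : Subst) : Ty → Ty
  | .var α => σ.ty α
  | .unit => .unit
  | .bool => .bool
  | .int => .int
  | .pair T₁ T₂ => .pair (T₁.subst σ) (T₂.subst σ)
  | .fn T₁ β T₂ => .fn (T₁.subst σ) (σ.beh β) (T₂.subst σ)
  | .ses ρ => .ses (σ.reg ρ)

def Sess.subst (σ : Subst) : Sess → Sess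
  | .done => .done
  | .out T η => .out (T.subst σ) (η.subst σ)
  | .inp T η => .inp (T.subst σ) (η.subst σ)
  | .del η₀ η => .del (η₀.subst σ) (η.subst σ)
  | .res η₀ η => .res (η₀.subst σ) (η.subst σ)
  | .ich I η => .ich I (fun i => (η i).subst σ)
  | .ech I₁ I₂ hd hn η => .ech I₁ I₂ hd hn (fun i => (η i).subst σ)
  | .var ψ => σ.ses ψ

def Beh.subst (σ : Subst) : Beh → Beh
  | .var β => .var (σ.beh β)
  | .tau => .tau
  | .seq b₁ b₂ => .seq (b₁.subst σ) (b₂.subst σ)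
  | .plus b₁ b₂ => .plus (b₁.subst σ) (b₂.subst σ)
  | .recur b β => .recur (b.subst σ) (σ.beh β)
  | .spawn b => .spawn (b.subst σ)
  | .push l η => .push l (η.subst σ)
  | .out ρ T => .out (σ.reg ρ) (T.subst σ)
  | .inp ρ T => .inp (σ.reg ρ) (T.subst σ)
  | .del ρ ρ' => .del (σ.reg ρ) (σ.reg ρ')
  | .res ρ l => .res (σ.reg ρ) l
  | .sel ρ i => .sel (σ.reg ρ) i
  | .offer ρ I b => .offer (σ.reg ρ) I (fun i => (b i).subst σ)

def Region.subst (σ : Subst) : Region → Region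
  | .lab l => .lab l
  | .var ρ => .var (σ.reg ρ)

def Constraint.subst (σ : Subst) : Constraint → Constraint
  | .tySub T T' => .tySub (T.subst σ) (T'.subst σ)
  | .cfdTy T => .cfdTy (T.subst σ)
  | .cfdBeh b => .cfdBeh (b.subst σ)
  | .behSub b β => .behSub (b.subst σ) (σ.beh β)
  | .region ρ r => .region (σ.reg ρ) (r.subst σ)
  | .reqChan c η => .reqChan c (η.subst σ)
  | .accChan c η => .accChan c (η.subst σ)
  | .dual η η' => .dual (η.subst σ) (η'.subst σ)

def Constraints.subst (σ : Subst) (C : Constraints) : Constraints := C.map (Constraint.subst σ)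

/-- `dom σ ⊆ γ`. -/
def Subst.DomIn (σ : Subst) (γ : List Var) : Prop :=
  (∀ α, Var.ty α ∉ γ → σ.ty α = .var α) ∧
  (∀ β, Var.beh β ∉ γ → σ.beh β = β) ∧
  (∀ ρ, Var.reg ρ ∉ γ → σ.reg ρ = ρ) ∧
  (∀ ψ, Var.ses ψ ∉ γ → σ.ses ψ = .var ψ)

/-- The substitution that replaces session variables only. -/
def Subst.ofSes (f : ℕ → Sess) : Subst := ⟨Ty.var, id, id, f⟩

/-- A session type without session variables. -/
def Sess.IsClosed (η : Sess) : Prop := ∀ ψ, Var.ses ψ ∉ η.fv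

/-! ### Derivable constraints -/

/-- `C ⊢ r ∼ r'`: the equivalence generated by the region equalities in `C`. -/
def RegEq (C : Constraints) : Region → Region → Prop :=
  Relation.EqvGen fun r r' => ∃ ρ, r = .var ρ ∧ Constraint.region ρ r' ∈ C

/-- `C ⊢ b ⊆ b'`: the reflexive transitive closure of the behaviour inclusions in `C`. -/
def BehSub (C : Constraints) : Beh → Beh → Prop :=
  Relation.ReflTransGen fun b b' => ∃ β, b' = .var β ∧ Constraint.behSub b β ∈ C

/-- Functional subtyping `C ⊢ T ⊆ T'`. -/
inductive TySub (C : Constraints) : Ty → Ty → Prop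
  | ax {T T'} : Constraint.tySub T T' ∈ C → TySub C T T'
  | refl (T) : TySub C T T
  | trans {T₁ T₂ T₃} : TySub C T₁ T₂ → TySub C T₂ T₃ → TySub C T₁ T₃
  | ses {ρ ρ'} : RegEq C (.var ρ) (.var ρ') → TySub C (.ses ρ) (.ses ρ')
  | pair {T₁ T₂ T₁' T₂'} : TySub C T₁ T₁' → TySub C T₂ T₂' →
      TySub C (.pair T₁ T₂) (.pair T₁' T₂')
  | fn {T₁ T₂ T₁' T₂' β β'} : TySub C T₁' T₁ → BehSub C (.var β) (.var β') → TySub C T₂ T₂' →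
      TySub C (.fn T₁ β T₂) (.fn T₁' β' T₂')

/-- Session subtyping `C ⊢ η <: η'` (Gay and Hole, with active and inactive external labels). -/
inductive SessSub (C : Constraints) : Sess → Sess → Prop
  | done : SessSub C .done .done
  | var (ψ) : SessSub C (.var ψ) (.var ψ)
  | out {T T' η η'} : TySub C T' T → SessSub C η η' → SessSub C (.out T η) (.out T' η')
  | inp {T T' η η'} : TySub C T T' → SessSub C η η' → SessSub C (.inp T η) (.inp T' η')
  | del {η₀ η₀' η η'} : SessSub C η₀' η₀ → SessSub C η η' → SessSub C (.del η₀ η) (.del η₀' η')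
  | res {η₀ η₀' η η'} : SessSub C η₀ η₀' → SessSub C η η' → SessSub C (.res η₀ η) (.res η₀' η')
  | ich {I J η η'} : J ⊆ I →
      (∀ (i : ℕ) (hi : i ∈ I) (hj : i ∈ J), SessSub C (η ⟨i, hi⟩) (η' ⟨i, hj⟩)) →
      SessSub C (.ich I η) (.ich J η')
  | ech {I₁ I₂ hd hn η J₁ J₂ hd' hn' η'} : I₁ ⊆ J₁ → J₁ ∪ J₂ ⊆ I₁ ∪ I₂ →
      (∀ (i : ℕ) (hi : i ∈ I₁ ∪ I₂) (hj : i ∈ J₁ ∪ J₂), SessSub C (η ⟨i, hi⟩) (η' ⟨i, hj⟩)) →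
      SessSub C (.ech I₁ I₂ hd hn η) (.ech J₁ J₂ hd' hn' η')

/-- Duality `C ⊢ η ⋈ η'`: four rules and their symmetric versions. -/
inductive Dual (C : Constraints) : Sess → Sess → Prop
  | done : Dual C .done .done
  | outInp {T T' η η'} : TySub C T T' → Dual C η η' → Dual C (.out T η) (.inp T' η')
  | inpOut {T T' η η'} : TySub C T T' → Dual C η' η → Dual C (.inp T' η') (.out T η)
  | delRes {η₀ η₀' η η'} : SessSub C η₀ η₀' → Dual C η η' → Dual C (.del η₀ η) (.res η₀' η')
  | resDel {η₀ η₀' η η'} : SessSub C η₀ η₀' → Dual C η' η → Dual C (.res η₀' η') (.del η₀ η)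
  | ichEch {I η J₁ J₂ hd hn η'} : I ⊆ J₁ →
      (∀ (i : ℕ) (hi : i ∈ I) (hj : i ∈ J₁ ∪ J₂), Dual C (η ⟨i, hi⟩) (η' ⟨i, hj⟩)) →
      Dual C (.ich I η) (.ech J₁ J₂ hd hn η')
  | echIch {I η J₁ J₂ hd hn η'} : I ⊆ J₁ →
      (∀ (i : ℕ) (hi : i ∈ I) (hj : i ∈ J₁ ∪ J₂), Dual C (η' ⟨i, hj⟩) (η ⟨i, hi⟩)) →
      Dual C (.ech J₁ J₂ hd hn η') (.ich I η)

/-- `C ⊢ confined(o)` for types `o = inl T` and behaviours `o = inr b`. -/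
inductive Confined (C : Constraints) : Ty ⊕ Beh → Prop
  | tau : Confined C (.inr .tau)
  | recur (b β) : Confined C (.inr (.recur b β))
  | axBeh {b} : Constraint.cfdBeh b ∈ C → Confined C (.inr b)
  | plus {b₁ b₂} : Confined C (.inr b₁) → Confined C (.inr b₂) → Confined C (.inr (.plus b₁ b₂))
  | plusLeft {b₁ b₂} : Confined C (.inr (.plus b₁ b₂)) → Confined C (.inr b₁)
  | plusRight {b₁ b₂} : Confined C (.inr (.plus b₁ b₂)) → Confined C (.inr b₂)
  | seq {b₁ b₂} : Confined C (.inr b₁) → Confined C (.inr b₂) → Confined C (.inr (.seq b₁ b₂))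
  | seqLeft {b₁ b₂} : Confined C (.inr (.seq b₁ b₂)) → Confined C (.inr b₁)
  | seqRight {b₁ b₂} : Confined C (.inr (.seq b₁ b₂)) → Confined C (.inr b₂)
  | spawn {b} : Confined C (.inr b) → Confined C (.inr (.spawn b))
  | spawnBody {b} : Confined C (.inr (.spawn b)) → Confined C (.inr b)
  | subBeh {b₁ b₂} : BehSub C b₁ b₂ → Confined C (.inr b₂) → Confined C (.inr b₁)
  | unit : Confined C (.inl .unit)
  | bool : Confined C (.inl .bool)
  | int : Confined C (.inl .int)
  | axTy {T} : Constraint.cfdTy T ∈ C → Confined C (.inl T)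
  | subTy {T₁ T₂} : TySub C T₁ T₂ → Confined C (.inl T₂) → Confined C (.inl T₁)
  | subTyBack {T₂} : (∀ T₁, TySub C T₁ T₂ → Confined C (.inl T₁)) → Confined C (.inl T₂)
  | fn {T T' β} : Confined C (.inl T) → Confined C (.inl T') → Confined C (.inr (.var β)) →
      Confined C (.inl (.fn T β T'))
  | fnDom {T T' β} : Confined C (.inl (.fn T β T')) → Confined C (.inl T)
  | fnCod {T T' β} : Confined C (.inl (.fn T β T')) → Confined C (.inl T')
  | fnBeh {T T' β} : Confined C (.inl (.fn T β T')) → Confined C (.inr (.var β))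
  | pair {T T'} : Confined C (.inl T) → Confined C (.inl T') → Confined C (.inl (.pair T T'))
  | pairLeft {T T'} : Confined C (.inl (.pair T T')) → Confined C (.inl T)
  | pairRight {T T'} : Confined C (.inl (.pair T T')) → Confined C (.inl T')

/-- `C ⊢ c` for a single constraint `c`. -/
def Entails (C : Constraints) : Constraint → Prop
  | .tySub T T' => TySub C T T'
  | .cfdTy T => Confined C (.inl T)
  | .cfdBeh b => Confined C (.inr b)
  | .behSub b β => BehSub C b (.var β)
  | .region ρ r => RegEq C (.var ρ) r
  | .reqChan c η => Constraint.reqChan c η ∈ C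
  | .accChan c η => Constraint.accChan c η ∈ C
  | .dual η η' => Constraint.dual η η' ∈ C ∨ Dual C η η'

/-- The schema `S` is solvable by `C` and `σ`. -/
def Scheme.SolvableBy (S : Scheme) (C : Constraints) (σ : Subst) : Prop :=
  σ.DomIn S.vars ∧ ∀ c ∈ S.constr, Entails C (c.subst σ)

/-! ### Well-formed and valid constraint environments -/

/-- `T` and `T'` do not have distinct head constructors, and if they have the same head
constructor then their components are related accordingly. -/
def Ty.Consistent (C : Constraints) : Ty → Ty → Prop
  | .var _, _ => True
  | _, .var _ => True
  | .unit, .unit => True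
  | .bool, .bool => True
  | .int, .int => True
  | .pair T₁ T₂, .pair T₁' T₂' => TySub C T₁ T₁' ∧ TySub C T₂ T₂'
  | .fn T₁ β T₂, .fn T₁' β' T₂' =>
      TySub C T₁' T₁ ∧ BehSub C (.var β) (.var β') ∧ TySub C T₂ T₂'
  | .ses ρ, .ses ρ' => RegEq C (.var ρ) (.var ρ')
  | _, _ => False

/-- The behaviour variable `β` occurs in a behaviour (occurrences in type annotations and the
annotation of `rec` do not count). -/
def Beh.Mentions (β : ℕ) : Beh → Prop
  | .var β' => β' = β
  | .seq b₁ b₂ => b₁.Mentions β ∨ b₂.Mentions β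
  | .plus b₁ b₂ => b₁.Mentions β ∨ b₂.Mentions β
  | .recur b _ => b.Mentions β
  | .spawn b => b.Mentions β
  | .offer _ _ b => ∃ i, (b i).Mentions β
  | _ => False

/-- A dependency of `β` on `β'` through a constraint that is not of the form `rec_β b ⊆ β`. -/
def NonRecDep (C : Constraints) (β β' : ℕ) : Prop :=
  ∃ b, Constraint.behSub b β ∈ C ∧ (∀ b₀, b ≠ .recur b₀ β) ∧ b.Mentions β'

/-- Session operations. -/
def Beh.IsSessionOp : Beh → Prop
  | .out _ _ => True
  | .inp _ _ => True
  | .del _ _ => True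
  | .res _ _ => True
  | .sel _ _ => True
  | .offer _ _ _ => True
  | _ => False

structure WellFormed (C : Constraints) : Prop where
  typeConsistent : ∀ T T', TySub C T T' → T.Consistent C T'
  regionConsistent : ∀ l l', RegEq C (.lab l) (.lab l') → l = l'
  /-- every cycle of behaviour constraints contains some `rec_β b ⊆ β` -/
  compactCycles : ∀ β, ¬ Relation.TransGen (NonRecDep C) β β
  compactVar : ∀ b β β', Constraint.behSub (.recur b β) β' ∈ C → β = β'
  compactUnique : ∀ b b' β, Constraint.behSub (.recur b β) β ∈ C →
    Constraint.behSub b' β ∈ C → b' = .recur b β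
  confinedTy : ∀ T, Confined C (.inl T) → ∀ ρ, T ≠ .ses ρ
  confinedBeh : ∀ b, Confined C (.inr b) → ¬ b.IsSessionOp

def Valid (C : Constraints) : Prop :=
  ∃ f : ℕ → Sess, (∀ ψ, (f ψ).IsClosed) ∧
    WellFormed (Constraints.subst (Subst.ofSes f) C) ∧
    ∀ c η η', Constraint.reqChan c η ∈ Constraints.subst (Subst.ofSes f) C →
      Constraint.accChan c η' ∈ Constraints.subst (Subst.ofSes f) C → Dual C η η'

/-! ### Expressions and their operational semantics -/

/-- Session endpoints: a countably infinite set with a fixed-point-free involution. -/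
abbrev Endpoint := ℕ × Bool

/-- The dual endpoint. -/
def Endpoint.bar (p : Endpoint) : Endpoint := (p.1, !p.2)

/-- Constants, including the session primitives annotated with region labels `l`. -/
inductive Const : Type
  | unit
  | bool (v : Bool)
  | int (n : ℤ)
  | request (l c : ℕ)
  | accept (l c : ℕ)
  | send
  | recv
  | select (i : ℕ)
  | deleg
  | resume (l : ℕ)

/-- Expressions. `endp p l` is the endpoint `p^l` generated at label `l`; `fn x e` is
`fun x ⇒ e`; `fix f x e` is the recursive function `f(x) = e`; `branch e I b` is
`match e {L_i : b_i}` with `i ∈ I`. -/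
inductive Expr : Type
  | var (x : ℕ)
  | const (k : Const)
  | endp (p : Endpoint) (l : ℕ)
  | pair (e₁ e₂ : Expr)
  | fn (x : ℕ) (e : Expr)
  | fix (f x : ℕ) (e : Expr)
  | app (e₁ e₂ : Expr)
  | letE (x : ℕ) (e₁ e₂ : Expr)
  | ite (e₁ e₂ e₃ : Expr)
  | spawn (e : Expr)
  | branch (e : Expr) (I : Finset ℕ) (b : {i // i ∈ I} → Expr)

/-- The unit value. -/
abbrev Expr.unit : Expr := .const .unit

inductive IsValue : Expr → Prop
  | var (x) : IsValue (.var x)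
  | const (k) : IsValue (.const k)
  | endp (p l) : IsValue (.endp p l)
  | pair {v₁ v₂} : IsValue v₁ → IsValue v₂ → IsValue (.pair v₁ v₂)
  | fn (x e) : IsValue (.fn x e)
  | fix (f x e) : IsValue (.fix f x e)

/-- `e.subst x v` is `e[v/x]`. Processes are closed, so only closed values are substituted and no
variable can be captured. -/
def Expr.subst (e : Expr) (x : ℕ) (v : Expr) : Expr :=
  match e with
  | .var y => if y = x then v else .var y
  | .const k => .const k
  | .endp p l => .endp p l
  | .pair e₁ e₂ => .pair (e₁.subst x v) (e₂.subst x v)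
  | .fn y e => if y = x then .fn y e else .fn y (e.subst x v)
  | .fix f y e => if f = x ∨ y = x then .fix f y e else .fix f y (e.subst x v)
  | .app e₁ e₂ => .app (e₁.subst x v) (e₂.subst x v)
  | .letE y e₁ e₂ => .letE y (e₁.subst x v) (if y = x then e₂ else e₂.subst x v)
  | .ite e₁ e₂ e₃ => .ite (e₁.subst x v) (e₂.subst x v) (e₃.subst x v)
  | .spawn e => .spawn (e.subst x v)
  | .branch e I b => .branch (e.subst x v) I (fun i => (b i).subst x v)

/-- The annotated endpoints `p^l` that occur in an expression. -/
def Expr.endps : Expr → Set (Endpoint × ℕ)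
  | .var _ => ∅
  | .const _ => ∅
  | .endp p l => {(p, l)}
  | .pair e₁ e₂ => e₁.endps ∪ e₂.endps
  | .fn _ e => e.endps
  | .fix _ _ e => e.endps
  | .app e₁ e₂ => e₁.endps ∪ e₂.endps
  | .letE _ e₁ e₂ => e₁.endps ∪ e₂.endps
  | .ite e₁ e₂ e₃ => e₁.endps ∪ e₂.endps ∪ e₃.endps
  | .spawn e => e.endps
  | .branch e _ b => e.endps ∪ ⋃ i, (b i).endps

/-- Evaluation contexts. -/
inductive ECtx : Type
  | hole
  | pairL (E : ECtx) (e : Expr)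
  | pairR (v : Expr) (hv : IsValue v) (E : ECtx)
  | appL (E : ECtx) (e : Expr)
  | appR (v : Expr) (hv : IsValue v) (E : ECtx)
  | letE (x : ℕ) (E : ECtx) (e : Expr)
  | ite (E : ECtx) (e₁ e₂ : Expr)
  | spawn (E : ECtx)
  | branch (E : ECtx) (I : Finset ℕ) (b : {i // i ∈ I} → Expr)

/-- `E[e]`. -/
def ECtx.fill (t : Expr) : ECtx → Expr
  | .hole => t
  | .pairL E e => .pair (E.fill t) e
  | .pairR v _ E => .pair v (E.fill t)
  | .appL E e => .app (E.fill t) e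
  | .appR v _ E => .app v (E.fill t)
  | .letE x E e => .letE x (E.fill t) e
  | .ite E e₁ e₂ => .ite (E.fill t) e₁ e₂
  | .spawn E => .spawn (E.fill t)
  | .branch E I b => .branch (E.fill t) I b

/-- Beta reductions of redexes. In `fix` the argument is substituted first; as both substituted
values are closed, this matters only if `f = x`, where the inner binder `x` then takes
precedence. -/
inductive Beta : Expr → Expr → Prop
  | iteTrue (e₁ e₂) : Beta (.ite (.const (.bool true)) e₁ e₂) e₁
  | iteFalse (e₁ e₂) : Beta (.ite (.const (.bool false)) e₁ e₂) e₂
  | letE {x v e} : IsValue v → Beta (.letE x v e) (e.subst x v)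
  | fn {x e v} : IsValue v → Beta (.app (.fn x e) v) (e.subst x v)
  | fix {f x e v} : IsValue v →
      Beta (.app (.fix f x e) v) ((e.subst x v).subst f (.fix f x e))

/-- Systems: parallel compositions of processes, up to reordering. -/
abbrev System := Multiset Expr

/-- Internal steps of systems. -/
inductive System.IntStep : System → System → Prop
  | beta (E : ECtx) {e e' : Expr} (S : System) : Beta e e' →
      System.IntStep (E.fill e ::ₘ S) (E.fill e' ::ₘ S)
  | spawn (E : ECtx) {v : Expr} (S : System) : IsValue v →
      System.IntStep (E.fill (.spawn v) ::ₘ S) (E.fill .unit ::ₘ .app v .unit ::ₘ S)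

/-- Neither `p` nor its dual occurs in the system. -/
def System.Fresh (p : Endpoint) (S : System) : Prop :=
  ∀ e ∈ S, ∀ l, (p, l) ∉ e.endps ∧ (p.bar, l) ∉ e.endps

/-- Communication steps of systems: session initiation, communication of a value, delegation and
selection. A delegated endpoint is annotated with the label of the receiving `resume`. -/
inductive System.ComStep : System → System → Prop
  | init (E₁ E₂ : ECtx) (l₁ l₂ c : ℕ) (p : Endpoint) (S : System) :
      System.Fresh p (E₁.fill (.app (.const (.request l₁ c)) .unit) ::ₘ
        E₂.fill (.app (.const (.accept l₂ c)) .unit) ::ₘ S) →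
      System.ComStep
        (E₁.fill (.app (.const (.request l₁ c)) .unit) ::ₘ
          E₂.fill (.app (.const (.accept l₂ c)) .unit) ::ₘ S)
        (E₁.fill (.endp p l₁) ::ₘ E₂.fill (.endp p.bar l₂) ::ₘ S)
  | comm (E₁ E₂ : ECtx) (l₁ l₂ : ℕ) (p : Endpoint) {v : Expr} (S : System) : IsValue v →
      System.ComStep
        (E₁.fill (.app (.const .send) (.pair (.endp p l₁) v)) ::ₘ
          E₂.fill (.app (.const .recv) (.endp p.bar l₂)) ::ₘ S)
        (E₁.fill .unit ::ₘ E₂.fill v ::ₘ S)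
  | deleg (E₁ E₂ : ECtx) (l₁ l₁' l₂ l : ℕ) (p p' : Endpoint) (S : System) :
      System.ComStep
        (E₁.fill (.app (.const .deleg) (.pair (.endp p l₁) (.endp p' l₁'))) ::ₘ
          E₂.fill (.app (.const (.resume l)) (.endp p.bar l₂)) ::ₘ S)
        (E₁.fill .unit ::ₘ E₂.fill (.endp p' l) ::ₘ S)
  | select (E₁ E₂ : ECtx) (l₁ l₂ : ℕ) (p : Endpoint) (I : Finset ℕ)
      (b : {i // i ∈ I} → Expr) (j : {i // i ∈ I}) (S : System) :
      System.ComStep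
        (E₁.fill (.app (.const (.select j.1)) (.endp p l₁)) ::ₘ
          E₂.fill (.branch (.endp p.bar l₂) I b) ::ₘ S)
        (E₁.fill .unit ::ₘ E₂.fill (b j) ::ₘ S)

/-! ### First level: the type-and-effect system -/

/-- The type schemas of the constants. -/
def Const.typeOf : Const → Scheme
  | .unit => .mono .unit
  | .bool _ => .mono .bool
  | .int _ => .mono .int
  | .request l c =>
      ⟨[.beh 0, .reg 0, .ses 0],
        [.behSub (.push l (.var 0)) 0, .region 0 (.lab l), .reqChan c (.var 0)],
        .fn .unit 0 (.ses 0)⟩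
  | .accept l c =>
      ⟨[.beh 0, .reg 0, .ses 0],
        [.behSub (.push l (.var 0)) 0, .region 0 (.lab l), .accChan c (.var 0)],
        .fn .unit 0 (.ses 0)⟩
  | .send =>
      ⟨[.ty 0, .beh 0, .reg 0],
        [.behSub (.out 0 (.var 0)) 0, .cfdTy (.var 0)],
        .fn (.pair (.ses 0) (.var 0)) 0 .unit⟩
  | .recv =>
      ⟨[.ty 0, .beh 0, .reg 0],
        [.behSub (.inp 0 (.var 0)) 0, .cfdTy (.var 0)],
        .fn (.ses 0) 0 (.var 0)⟩
  | .select i =>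
      ⟨[.beh 0, .reg 0], [.behSub (.sel 0 i) 0], .fn (.ses 0) 0 .unit⟩
  | .deleg =>
      ⟨[.beh 0, .reg 0, .reg 1], [.behSub (.del 0 1) 0],
        .fn (.pair (.ses 0) (.ses 1)) 0 .unit⟩
  | .resume l =>
      ⟨[.beh 0, .reg 0, .reg 1], [.behSub (.res 0 l) 0, .region 1 (.lab l)],
        .fn (.ses 0) 0 (.ses 1)⟩

/-- Type environments. -/
abbrev Env := ℕ → Option Scheme

def Env.empty : Env := fun _ => none

/-- `Γ, x : S`. -/
def Env.extend (Γ : Env) (x : ℕ) (S : Scheme) : Env := fun y => if y = x then some S else Γ y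

def Env.fv (Γ : Env) : Set Var := {γ | ∃ x S, Γ x = some S ∧ γ ∈ S.fv}

/-- The judgement `C; Γ ⊢ e : S ▹ b`. -/
inductive Typing : Constraints → Env → Expr → Scheme → Beh → Prop
  | var {C Γ x S} : Γ x = some S → Typing C Γ (.var x) S .tau
  | const {C Γ} (k : Const) : Typing C Γ (.const k) k.typeOf .tau
  | endp {C Γ p l ρ} : RegEq C (.var ρ) (.lab l) → Typing C Γ (.endp p l) (.mono (.ses ρ)) .tau
  | pair {C Γ e₁ e₂ T₁ T₂ b₁ b₂} :
      Typing C Γ e₁ (.mono T₁) b₁ → Typing C Γ e₂ (.mono T₂) b₂ →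
      Typing C Γ (.pair e₁ e₂) (.mono (.pair T₁ T₂)) (.seq b₁ b₂)
  | letE {C Γ x e₁ e₂ S T b₁ b₂} :
      Typing C Γ e₁ S b₁ → Typing C (Γ.extend x S) e₂ (.mono T) b₂ →
      Typing C Γ (.letE x e₁ e₂) (.mono T) (.seq b₁ b₂)
  | ite {C Γ e₁ e₂ e₃ T b₁ b₂ b₃} :
      Typing C Γ e₁ (.mono .bool) b₁ →
      Typing C Γ e₂ (.mono T) b₂ → Typing C Γ e₃ (.mono T) b₃ →
      Typing C Γ (.ite e₁ e₂ e₃) (.mono T) (.seq b₁ (.plus b₂ b₃))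
  | app {C Γ e₁ e₂ T T' β b₁ b₂} :
      Typing C Γ e₁ (.mono (.fn T' β T)) b₁ → Typing C Γ e₂ (.mono T') b₂ →
      Typing C Γ (.app e₁ e₂) (.mono T) (.seq (.seq b₁ b₂) (.var β))
  | fn {C Γ x e T T' β} :
      Typing C (Γ.extend x (.mono T)) e (.mono T') (.var β) →
      Typing C Γ (.fn x e) (.mono (.fn T β T')) .tau
  | fix {C Γ f x e T T' b β} :
      Typing C ((Γ.extend f (.mono (.fn T β T'))).extend x (.mono T)) e (.mono T') b →
      Confined C (.inl T) → Confined C (.inl T') → BehSub C (.recur b β) (.var β) →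
      Typing C Γ (.fix f x e) (.mono (.fn T β T')) .tau
  | spawn {C Γ e β b} :
      Typing C Γ e (.mono (.fn .unit β .unit)) b →
      Typing C Γ (.spawn e) (.mono .unit) (.seq b (.spawn (.var β)))
  | branch {C Γ e ρ b I T} {es : {i // i ∈ I} → Expr} {bs : {i // i ∈ I} → Beh} :
      Typing C Γ e (.mono (.ses ρ)) b → (∀ i, Typing C Γ (es i) (.mono T) (bs i)) →
      Typing C Γ (.branch e I es) (.mono T) (.seq b (.offer ρ I bs))
  | sub {C Γ e T T' b β} :
      Typing C Γ e (.mono T) b → TySub C T T' → BehSub C b (.var β) →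
      Typing C Γ e (.mono T') (.var β)
  | inst {C Γ e S b σ} :
      Typing C Γ e S b → S.SolvableBy C σ → Typing C Γ e (.mono (S.body.subst σ)) b
  | gen {C Γ e γ C₀ T b} :
      Typing (C ++ C₀) Γ e (.mono T) b →
      (∀ g ∈ γ, g ∉ Env.fv Γ ∧ g ∉ Constraints.fv C ∧ g ∉ b.fv) →
      (∀ g ∈ Constraints.fv C₀, g ∈ γ) →
      (∃ σ, Scheme.SolvableBy ⟨γ, C₀, T⟩ C σ) →
      Typing C Γ e ⟨γ, C₀, T⟩ b

/-! ### Second level: abstract interpretation of behaviours -/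

/-- Stacks of static endpoints, top frame first. `used` records the labels of frames that have
been on the stack and have been removed from it. -/
structure Stack : Type where
  frames : List (ℕ × Sess)
  used : Finset ℕ

/-- The empty stack, onto which no label has been pushed yet. -/
def Stack.empty : Stack := ⟨[], ∅⟩

/-- All labels that are or have been on the stack. -/
def Stack.labels (Δ : Stack) : Finset ℕ := Δ.used ∪ (Δ.frames.map Prod.fst).toFinset

/-- `C` with all inclusions in `β` replaced by `τ ⊆ β`. -/
def Constraints.cut (C : Constraints) (β : ℕ) : Constraints :=
  .behSub .tau β :: C.filter (fun c => match c with
    | .behSub _ β' => β' != β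
    | _ => true)

/-- The transitions `Δ ⊨ b →_C Δ' ⊨ b'`. The rules `recur` and `spawn` have a premise
`ε ⊨ b ⇓_C`, for which the parameter `R` stands; see `Normalizes`. -/
inductive AStep (R : Constraints → Beh → Prop) (C : Constraints) :
    Stack × Beh → Stack × Beh → Prop
  | fin {l fs u b} : AStep R C (⟨(l, .done) :: fs, u⟩, b) (⟨fs, insert l u⟩, b)
  | beta {Δ b β} : BehSub C b (.var β) → AStep R C (Δ, .var β) (Δ, b)
  | plusLeft {Δ b₁ b₂} : AStep R C (Δ, .plus b₁ b₂) (Δ, b₁)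
  | plusRight {Δ b₁ b₂} : AStep R C (Δ, .plus b₁ b₂) (Δ, b₂)
  | push {Δ : Stack} {l η} : l ∉ Δ.labels →
      AStep R C (Δ, .push l η) (⟨(l, η) :: Δ.frames, Δ.used⟩, .tau)
  | out {l T T' η fs u ρ} : RegEq C (.var ρ) (.lab l) → TySub C T' T →
      AStep R C (⟨(l, .out T η) :: fs, u⟩, .out ρ T') (⟨(l, η) :: fs, u⟩, .tau)
  | inp {l T T' η fs u ρ} : RegEq C (.var ρ) (.lab l) → TySub C T T' →
      AStep R C (⟨(l, .inp T η) :: fs, u⟩, .inp ρ T') (⟨(l, η) :: fs, u⟩, .tau)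
  | del {l l' η₀ η₀' η fs u ρ ρ'} : RegEq C (.var ρ) (.lab l) → RegEq C (.var ρ') (.lab l') →
      SessSub C η₀' η₀ →
      AStep R C (⟨(l, .del η₀ η) :: (l', η₀') :: fs, u⟩, .del ρ ρ')
        (⟨(l, η) :: fs, insert l' u⟩, .tau)
  | res {l l' η₀ η u ρ} : l ≠ l' → RegEq C (.var ρ) (.lab l) →
      AStep R C (⟨[(l, .res η₀ η)], u⟩, .res ρ l') (⟨[(l, η), (l', η₀)], u⟩, .tau)
  | ich {l I η fs u ρ} (j : {i // i ∈ I}) : RegEq C (.var ρ) (.lab l) →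
      AStep R C (⟨(l, .ich I η) :: fs, u⟩, .sel ρ j.1) (⟨(l, η j) :: fs, u⟩, .tau)
  | ech {l I₁ I₂ hd hn η fs u ρ J b} (k : ℕ) (hk : k ∈ J) (hk' : k ∈ I₁ ∪ I₂) :
      RegEq C (.var ρ) (.lab l) → I₁ ⊆ J → J ⊆ I₁ ∪ I₂ →
      AStep R C (⟨(l, .ech I₁ I₂ hd hn η) :: fs, u⟩, .offer ρ J b)
        (⟨(l, η ⟨k, hk'⟩) :: fs, u⟩, b ⟨k, hk⟩)
  | recur {Δ b β} : R (C.cut β) b → AStep R C (Δ, .recur b β) (Δ, .tau)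
  | spawn {Δ b} : R C b → AStep R C (Δ, .spawn b) (Δ, .tau)
  | seq {Δ Δ' b₁ b₁' b₂} : AStep R C (Δ, b₁) (Δ', b₁') →
      AStep R C (Δ, .seq b₁ b₂) (Δ', .seq b₁' b₂)
  | tau {Δ b} : AStep R C (Δ, .seq .tau b) (Δ, b)

/-- All configurations that are reachable from `Δ ⊨ b` and cannot take a step are of the form
`ε ⊨ τ`. -/
def NormalizesWith (R : Constraints → Beh → Prop) (C : Constraints) (Δ : Stack) (b : Beh) : Prop :=
  ∀ Δ' b', Relation.ReflTransGen (AStep R C) (Δ, b) (Δ', b') →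
    (¬ ∃ conf, AStep R C (Δ', b') conf) → b' = .tau ∧ Δ'.frames = []

/-- Strong normalization `Δ ⊨ b ⇓_C`. Transitions and strong normalization are defined in terms of
each other: the premise `R C b` of a transition is `ε ⊨ b ⇓_C`. As `NormalizesWith R` grows with
`R`, this recursive definition is expressed by its greatest fixed point (on behaviour-compact
constraint environments the recursion is well-founded and the fixed point unique). -/
def Normalizes (C : Constraints) (Δ : Stack) (b : Beh) : Prop :=
  ∃ R : Constraints → Beh → Prop,
    (∀ C' b', R C' b' → NormalizesWith R C' Stack.empty b') ∧ NormalizesWith R C Δ b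

/-! ### Running systems -/

/-- A stack frame `(p^l : η)` of a running process. -/
structure Frame : Type where
  endpoint : Endpoint
  label : ℕ
  sess : Sess

/-- A running process `(Δ ⊨ b, e)`; `frames` and `used` make up the stack `Δ`. -/
structure Proc : Type where
  frames : List Frame
  used : Finset ℕ
  beh : Beh
  expr : Expr

/-- The stack of a process without the endpoints. -/
def Proc.stack (P : Proc) : Stack := ⟨P.frames.map (fun f => (f.label, f.sess)), P.used⟩

/-- The process with one more frame on top of its stack. -/
def Proc.cons (f : Frame) (P : Proc) : Proc := { P with frames := f :: P.frames }

/-- Running systems, up to reordering. -/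
abbrev Config := Multiset Proc

/-- The underlying system of expressions. -/
def Config.erase (S : Config) : System := S.map Proc.expr

/-- `C ▹ S`: the running system `S` is well-typed. -/
def WellTyped (C : Constraints) (S : Config) : Prop :=
  WellFormed C ∧ Valid C ∧
    ∀ P ∈ S, (∃ T, Typing C Env.empty P.expr (.mono T) P.beh) ∧ Normalizes C P.stack P.beh

/-- Well-stackedness: pairs of dual endpoints with dual session types can be removed repeatedly
from the tops of two stacks until all stacks are empty. -/
inductive WellStacked (C : Constraints) : Config → Prop
  | nil {S : Config} : (∀ P ∈ S, P.frames = []) → WellStacked C S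
  | pair {S : Config} {P P' : Proc} {p : Endpoint} {l l' : ℕ} {η η' : Sess} :
      WellStacked C (P ::ₘ P' ::ₘ S) → Dual C η η' →
      (∀ Q ∈ P ::ₘ P' ::ₘ S, ∀ f ∈ Q.frames, f.endpoint ≠ p ∧ f.endpoint ≠ p.bar) →
      WellStacked C (P.cons ⟨p, l, η⟩ ::ₘ P'.cons ⟨p.bar, l', η'⟩ ::ₘ S)

/-- The annotations of the endpoints in each process agree with its stack: an endpoint in the
expression with the label of a stack frame is the endpoint of that frame. -/
def WellAnnotated (S : Config) : Prop :=
  ∀ P ∈ S, ∀ f ∈ P.frames, ∀ q : Endpoint, (q, f.label) ∈ P.expr.endps → q = f.endpoint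

/-- Internal steps of running systems. -/
def Config.IntStep (S S' : Config) : Prop := System.IntStep S.erase S'.erase

/-- Communication steps of running systems. -/
def Config.ComStep (S S' : Config) : Prop := System.ComStep S.erase S'.erase

/-- Finitely many internal steps. -/
def Config.IntSteps : Config → Config → Prop := Relation.ReflTransGen Config.IntStep

/-- A communication step, with internal steps before and after it. -/
def Config.WeakComStep (S S' : Config) : Prop :=
  ∃ S₁ S₂, S.IntSteps S₁ ∧ S₁.ComStep S₂ ∧ S₂.IntSteps S'

def Proc.Finished (P : Proc) : Prop := P.frames = [] ∧ P.beh = .tau ∧ IsValue P.expr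

/-- `P` has an infinite sequence of internal steps. -/
def Proc.Diverges (P : Proc) : Prop :=
  ∃ s : ℕ → Config, s 0 = {P} ∧ ∀ n, (s n).IntStep (s (n + 1))

/-- `P` is about to request or accept a session. -/
def Proc.Waiting (P : Proc) : Prop :=
  ∃ (E : ECtx) (l c : ℕ), P.expr = E.fill (.app (.const (.request l c)) .unit) ∨
    P.expr = E.fill (.app (.const (.accept l c)) .unit)

/-- Session primitives applied to values. -/
inductive SessionRedex : Expr → Prop
  | send {v} : IsValue v → SessionRedex (.app (.const .send) v)
  | recv {v} : IsValue v → SessionRedex (.app (.const .recv) v)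
  | deleg {v} : IsValue v → SessionRedex (.app (.const .deleg) v)
  | resume {l v} : IsValue v → SessionRedex (.app (.const (.resume l)) v)
  | select {i v} : IsValue v → SessionRedex (.app (.const (.select i)) v)
  | branch {v I b} : IsValue v → SessionRedex (.branch v I b)

/-- `P` is about to perform a session operation. -/
def Proc.Blocked (P : Proc) : Prop := ∃ (E : ECtx) (e : Expr), P.expr = E.fill e ∧ SessionRedex e

/-- `S` is the system `(F, D, W, B)` of finished, diverging, waiting and blocked processes. -/
def Config.Splits (S F D W B : Config) : Prop :=
  S = F + D + W + B ∧ (∀ P ∈ F, P.Finished) ∧ (∀ P ∈ D, P.Diverges) ∧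
    (∀ P ∈ W, P.Waiting) ∧ (∀ P ∈ B, P.Blocked)

end MLS

namespace MLS

/-! Internal steps need not touch stacks, so the argument keeps the stack and behaviour of each
process fixed while its expression runs. This works because subsumption in `HasTy` compares effects
only by their silent runs (`Le`), that is, by what they reach without pushing frames or
communicating. A reduct then has the very type and effect of its redex (`HasTy.beta`,
`HasTy.fill_congr`). Schemas are removed beforehand: `Typing.hasTy` reads them as the sets of
monotypes they stand for.

Strong normalization enters once, in `Safe.of_normalizes`. Up to finished frames on top of the
stack, a session operation reached silently is enabled by the top frame, a spawned behaviour
silently reaches no session operation, and a behaviour that can end silently has an empty stack. The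
difficulty is recursion: the abstract interpretation jumps from `rec_β b` to `τ` after checking `b`
on the empty stack with `β` cut, whereas evaluation unfolds `b` under the full constraints.
`Compact.hit_cut` closes the gap: a shortest silent run of `b` to a session operation does not
unfold `β` again, so it survives the cut and contradicts the check (`NormalizesWith.not_hit`).

Hence the invariant `Config.Ok` survives internal steps. In the end every process is a value or
blocked, and `Stacked.isValue` follows the pairs of dual top frames. Finished pairs are removed. For
any other pair neither process can be a value, as its stack is not used up; both are blocked, and by
`HasTy.ready` and the annotations each is about to perform the first operation of its frame on the
endpoint of that frame. Duality makes the two operations match, so a communication step exists,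
which is excluded. Thus all frames are finished, whereas a blocked process needs an unfinished one.
-/

/-! ### Type-level substitutions -/

/-- Two substitutions agree at a variable. -/
def Subst.AgreeAt (σ σ' : Subst) : Var → Prop
  | .ty α => σ.ty α = σ'.ty α
  | .beh β => σ.beh β = σ'.beh β
  | .reg ρ => σ.reg ρ = σ'.reg ρ
  | .ses ψ => σ.ses ψ = σ'.ses ψ

theorem Subst.AgreeAt.symm {σ σ' : Subst} : ∀ {g : Var}, σ.AgreeAt σ' g → σ'.AgreeAt σ g
  | .ty _, h | .beh _, h | .reg _, h | .ses _, h => Eq.symm h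

theorem Subst.AgreeAt.refl (σ : Subst) : ∀ g : Var, σ.AgreeAt σ g
  | .ty _ | .beh _ | .reg _ | .ses _ => rfl

/-- Apply `σ`, then `τ`. -/
def Subst.comp (σ τ : Subst) : Subst where
  ty α := (σ.ty α).subst τ
  beh β := τ.beh (σ.beh β)
  reg ρ := τ.reg (σ.reg ρ)
  ses ψ := (σ.ses ψ).subst τ

open Classical in
/-- The substitution that is `σ` on the variables in `γ` and `τ` elsewhere. -/
noncomputable def Subst.mix (γ : List Var) (σ τ : Subst) : Subst where
  ty α := if Var.ty α ∈ γ then σ.ty α else τ.ty α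
  beh β := if Var.beh β ∈ γ then σ.beh β else τ.beh β
  reg ρ := if Var.reg ρ ∈ γ then σ.reg ρ else τ.reg ρ
  ses ψ := if Var.ses ψ ∈ γ then σ.ses ψ else τ.ses ψ

theorem Subst.mix_agree_of_mem {γ : List Var} {σ τ : Subst} {g : Var} (h : g ∈ γ) :
    (Subst.mix γ σ τ).AgreeAt σ g := by
  cases g <;> simp [Subst.mix, Subst.AgreeAt, h]

theorem Subst.mix_agree_of_notMem {γ : List Var} {σ τ : Subst} {g : Var} (h : g ∉ γ) :
    (Subst.mix γ σ τ).AgreeAt τ g := by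
  cases g <;> simp [Subst.mix, Subst.AgreeAt, h]

theorem Ty.subst_congr {σ σ' : Subst} :
    ∀ {T : Ty}, (∀ g ∈ T.fv, σ.AgreeAt σ' g) → T.subst σ = T.subst σ'
  | .var α, h => h (.ty α) rfl
  | .unit, _ | .bool, _ | .int, _ => rfl
  | .pair T₁ T₂, h => by
      simp only [Ty.subst]
      rw [subst_congr (T := T₁) fun g hg => h g (Or.inl hg),
        subst_congr (T := T₂) fun g hg => h g (Or.inr hg)]
  | .fn T₁ β T₂, h => by
      simp only [Ty.subst]
      rw [subst_congr (T := T₁) fun g hg => h g (Or.inl (Or.inl hg)),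
        subst_congr (T := T₂) fun g hg => h g (Or.inr hg),
        show σ.beh β = σ'.beh β from h (.beh β) (Or.inl (Or.inr rfl))]
  | .ses ρ, h => congrArg Ty.ses (h (.reg ρ) rfl)

theorem Sess.subst_congr {σ σ' : Subst} {η : Sess} (h : ∀ g ∈ η.fv, σ.AgreeAt σ' g) :
    η.subst σ = η.subst σ' := by
  induction η with
  | done => rfl
  | out T η ih =>
    simp only [Sess.subst]
    rw [Ty.subst_congr fun g hg => h g (Or.inl hg), ih fun g hg => h g (Or.inr hg)]
  | inp T η ih =>
    simp only [Sess.subst]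
    rw [Ty.subst_congr fun g hg => h g (Or.inl hg), ih fun g hg => h g (Or.inr hg)]
  | del η₀ η ih₀ ih =>
    simp only [Sess.subst]
    rw [ih₀ fun g hg => h g (Or.inl hg), ih fun g hg => h g (Or.inr hg)]
  | res η₀ η ih₀ ih =>
    simp only [Sess.subst]
    rw [ih₀ fun g hg => h g (Or.inl hg), ih fun g hg => h g (Or.inr hg)]
  | ich I η ih =>
    simp only [Sess.subst]
    congr 1
    exact funext fun i => ih i fun g hg => h g (Set.mem_iUnion.2 ⟨i, hg⟩)
  | ech I₁ I₂ hd hn η ih =>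
    simp only [Sess.subst]
    congr 1
    exact funext fun i => ih i fun g hg => h g (Set.mem_iUnion.2 ⟨i, hg⟩)
  | var ψ => exact h (.ses ψ) rfl

theorem Beh.subst_congr {σ σ' : Subst} {b : Beh} (h : ∀ g ∈ b.fv, σ.AgreeAt σ' g) :
    b.subst σ = b.subst σ' := by
  induction b with
  | var β => exact congrArg Beh.var (h (.beh β) rfl)
  | tau => rfl
  | seq b₁ b₂ ih₁ ih₂ | plus b₁ b₂ ih₁ ih₂ =>
    simp only [Beh.subst]
    rw [ih₁ fun g hg => h g (Or.inl hg), ih₂ fun g hg => h g (Or.inr hg)]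
  | recur b β ih =>
    simp only [Beh.subst]
    rw [ih fun g hg => h g (Or.inl hg), show σ.beh β = σ'.beh β from h (.beh β) (Or.inr rfl)]
  | spawn b ih => exact congrArg Beh.spawn (ih h)
  | push l η => exact congrArg (Beh.push l) (Sess.subst_congr h)
  | out ρ T | inp ρ T =>
    simp only [Beh.subst]
    rw [Ty.subst_congr fun g hg => h g (Or.inr hg),
      show σ.reg ρ = σ'.reg ρ from h (.reg ρ) (Or.inl rfl)]
  | del ρ ρ' =>
    simp only [Beh.subst]
    rw [show σ.reg ρ = σ'.reg ρ from h (.reg ρ) (Or.inl rfl),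
      show σ.reg ρ' = σ'.reg ρ' from h (.reg ρ') (Or.inr rfl)]
  | res ρ l => exact congrArg (Beh.res · l) (h (.reg ρ) rfl)
  | sel ρ i => exact congrArg (Beh.sel · i) (h (.reg ρ) rfl)
  | offer ρ I b ih =>
    simp only [Beh.subst]
    rw [show σ.reg ρ = σ'.reg ρ from h (.reg ρ) (Or.inl rfl)]
    congr 1
    exact funext fun i => ih i fun g hg => h g (Or.inr (Set.mem_iUnion.2 ⟨i, hg⟩))

theorem Ty.subst_comp (σ τ : Subst) (T : Ty) : T.subst (σ.comp τ) = (T.subst σ).subst τ := by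
  induction T <;> simp_all [Ty.subst, Subst.comp]

theorem Sess.subst_comp (σ τ : Subst) (η : Sess) :
    η.subst (σ.comp τ) = (η.subst σ).subst τ := by
  induction η <;> simp only [Sess.subst, Ty.subst_comp, *]
  rfl

theorem Beh.subst_comp (σ τ : Subst) (b : Beh) : b.subst (σ.comp τ) = (b.subst σ).subst τ := by
  induction b <;> simp only [Beh.subst, Ty.subst_comp, Sess.subst_comp, *] <;> rfl

theorem Region.subst_comp (σ τ : Subst) (r : Region) :
    r.subst (σ.comp τ) = (r.subst σ).subst τ := by
  cases r <;> rfl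

theorem Constraint.subst_comp (σ τ : Subst) (c : Constraint) :
    c.subst (σ.comp τ) = (c.subst σ).subst τ := by
  cases c <;>
    simp [Constraint.subst, Ty.subst_comp, Sess.subst_comp, Beh.subst_comp, Region.subst_comp] <;>
    rfl

theorem Ty.subst_var (T : Ty) : T.subst (Subst.ofSes Sess.var) = T := by
  induction T <;> simp_all [Ty.subst, Subst.ofSes]

theorem Sess.subst_var (η : Sess) : η.subst (Subst.ofSes Sess.var) = η := by
  induction η <;> simp only [Sess.subst, Ty.subst_var, *]
  rfl

theorem Beh.subst_var (b : Beh) : b.subst (Subst.ofSes Sess.var) = b := by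
  induction b <;> simp_all [Beh.subst, Ty.subst_var, Sess.subst_var] <;> simp [Subst.ofSes]

theorem Constraint.subst_congr {σ σ' : Subst} {c : Constraint}
    (h : ∀ g ∈ c.fv, σ.AgreeAt σ' g) : c.subst σ = c.subst σ' := by
  cases c with
  | tySub T T' =>
    exact congrArg₂ Constraint.tySub (Ty.subst_congr fun g hg => h g (Or.inl hg))
      (Ty.subst_congr fun g hg => h g (Or.inr hg))
  | cfdTy T => exact congrArg Constraint.cfdTy (Ty.subst_congr h)
  | cfdBeh b => exact congrArg Constraint.cfdBeh (Beh.subst_congr h)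
  | behSub b β =>
    exact congrArg₂ Constraint.behSub (Beh.subst_congr fun g hg => h g (Or.inl hg)) (h (.beh β) (Or.inr rfl))
  | region ρ r =>
    refine congrArg₂ Constraint.region (h (.reg ρ) (Or.inl rfl)) ?_
    cases r with
    | lab l => rfl
    | var ρ' => exact congrArg Region.var (h (.reg ρ') (Or.inr rfl))
  | reqChan c η => exact congrArg (Constraint.reqChan c) (Sess.subst_congr h)
  | accChan c η => exact congrArg (Constraint.accChan c) (Sess.subst_congr h)
  | dual η η' =>
    exact congrArg₂ Constraint.dual (Sess.subst_congr fun g hg => h g (Or.inl hg))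
      (Sess.subst_congr fun g hg => h g (Or.inr hg))

/-! ### Satisfaction of constraints -/

/-- Derivability of inclusions and region equalities; other constraints are ignored. -/
def Constraint.Holds (C : Constraints) : Constraint → Prop
  | .tySub T T' => TySub C T T'
  | .behSub b β => BehSub C b (.var β)
  | .region ρ r => RegEq C (.var ρ) r
  | _ => True

/-- The instance of `D` under `σ` holds in `C`. -/
def Sat (C : Constraints) (σ : Subst) (D : Constraints) : Prop :=
  ∀ c ∈ D, (c.subst σ).Holds C

theorem Entails.holds {C : Constraints} {c : Constraint} (h : Entails C c) : c.Holds C := by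
  cases c <;> first | exact h | trivial

theorem RegEq.subst {C D : Constraints} {σ : Subst} (hσ : Sat C σ D) {r r' : Region}
    (h : RegEq D r r') : RegEq C (r.subst σ) (r'.subst σ) := by
  induction h with
  | rel r r' h =>
    obtain ⟨ρ, rfl, h⟩ := h
    exact hσ _ h
  | refl r => exact .refl _
  | symm _ _ _ ih => exact .symm _ _ ih
  | trans _ _ _ _ _ ih ih' => exact .trans _ _ _ ih ih'

theorem BehSub.subst {C D : Constraints} {σ : Subst} (hσ : Sat C σ D) {b b' : Beh}
    (h : BehSub D b b') : BehSub C (b.subst σ) (b'.subst σ) := by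
  induction h with
  | refl => exact .refl
  | tail _ h ih =>
    obtain ⟨β, rfl, h⟩ := h
    exact ih.trans (hσ _ h)

theorem TySub.subst {C D : Constraints} {σ : Subst} (hσ : Sat C σ D) {T T' : Ty}
    (h : TySub D T T') : TySub C (T.subst σ) (T'.subst σ) := by
  induction h with
  | ax h => exact hσ _ h
  | refl T => exact .refl _
  | trans _ _ ih ih' => exact .trans ih ih'
  | ses h => exact .ses (RegEq.subst hσ h)
  | pair _ _ ih ih' => exact .pair ih ih'
  | fn _ h _ ih ih' => exact .fn ih (BehSub.subst hσ h) ih'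

theorem Constraint.Holds.subst {C D : Constraints} {σ : Subst} (hσ : Sat C σ D)
    {c : Constraint} (h : c.Holds D) : (c.subst σ).Holds C := by
  cases c with
  | tySub T T' => exact TySub.subst hσ h
  | behSub b β => exact BehSub.subst hσ h
  | region ρ r => exact RegEq.subst hσ h
  | _ => trivial

theorem Subst.DomIn.comp_agree {γ : List Var} {σ₀ σ : Subst} (h : σ₀.DomIn γ) {g : Var}
    (hg : g ∉ γ) : (σ₀.comp σ).AgreeAt σ g := by
  obtain ⟨h₁, h₂, h₃, h₄⟩ := h
  cases g with
  | ty α => simp [Subst.AgreeAt, Subst.comp, h₁ α hg, Ty.subst]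
  | beh β => simp [Subst.AgreeAt, Subst.comp, h₂ β hg]
  | reg ρ => simp [Subst.AgreeAt, Subst.comp, h₃ ρ hg]
  | ses ψ => simp [Subst.AgreeAt, Subst.comp, h₄ ψ hg, Sess.subst]

theorem Scheme.SolvableBy.sat_comp {C D : Constraints} {σ σ₀ : Subst} {S : Scheme}
    (hσ : Sat C σ D) (h : S.SolvableBy D σ₀) : Sat C (σ₀.comp σ) S.constr := fun c hc => by
  rw [Constraint.subst_comp]
  exact (h.2 c hc).holds.subst hσ

theorem Sat.congr {C D : Constraints} {σ σ' : Subst}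
    (h : ∀ g ∈ Constraints.fv D, σ.AgreeAt σ' g) (hσ : Sat C σ D) : Sat C σ' D := fun c hc => by
  rw [← Constraint.subst_congr fun g hg => h g ⟨c, hc, hg⟩]
  exact hσ c hc

/-- The monotypes that `C` derives from the instance of a schema under `σ`. -/
def Scheme.instances (C : Constraints) (σ : Subst) (S : Scheme) : Set Ty :=
  {T | ∃ σ' : Subst, (∀ g, g ∉ S.vars → σ'.AgreeAt σ g) ∧ Sat C σ' S.constr ∧
    T = S.body.subst σ'}

theorem Scheme.instances_mono (C : Constraints) (σ : Subst) (T : Ty) :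
    (Scheme.mono T).instances C σ = {T.subst σ} := by
  ext U
  constructor
  · rintro ⟨σ', h, -, rfl⟩
    exact Ty.subst_congr fun g _ => h g List.not_mem_nil
  · rintro rfl
    exact ⟨σ, fun g _ => .refl σ g, fun c hc => absurd hc List.not_mem_nil, rfl⟩

/-- The quantified variables are free to vary anyway: the witness `σ'` is kept on them and replaced
by `τ` elsewhere, which changes nothing on the variables that occur. -/
theorem Scheme.instances_subset {C : Constraints} {σ τ : Subst} {S : Scheme}
    (h : ∀ g ∈ S.fv, σ.AgreeAt τ g) : S.instances C σ ⊆ S.instances C τ := by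
  rintro _ ⟨σ', hσ', hs, rfl⟩
  have key : ∀ g ∈ S.body.fv ∪ Constraints.fv S.constr,
      σ'.AgreeAt (Subst.mix S.vars σ' τ) g := by
    intro g hg
    by_cases hv : g ∈ S.vars
    · exact (Subst.mix_agree_of_mem hv).symm
    · have h₁ := hσ' g hv
      have h₂ := h g ⟨hg, hv⟩
      have h₃ := (Subst.mix_agree_of_notMem (σ := σ') (τ := τ) hv).symm
      cases g <;> exact h₁.trans (h₂.trans h₃)
  exact ⟨Subst.mix S.vars σ' τ, fun g => Subst.mix_agree_of_notMem,
    hs.congr fun g hg => key g (Or.inr hg), Ty.subst_congr fun g hg => key g (Or.inl hg)⟩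

/-! ### Silent runs of behaviours -/

/-- `b` can be run to its end without pushing frames or performing session operations; a call of
a recursive function runs its body, and spawned behaviours are skipped. -/
inductive Silent (C : Constraints) : Beh → Prop
  | tau : Silent C .tau
  | seq {b₁ b₂} : Silent C b₁ → Silent C b₂ → Silent C (.seq b₁ b₂)
  | plusLeft {b₁ b₂} : Silent C b₁ → Silent C (.plus b₁ b₂)
  | plusRight {b₁ b₂} : Silent C b₂ → Silent C (.plus b₁ b₂)
  | beta {b β} : BehSub C b (.var β) → Silent C b → Silent C (.var β)
  | unfold {b β₀ β} : BehSub C (.recur b β₀) (.var β) → Silent C b → Silent C (.var β)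
  | spawn (b) : Silent C (.spawn b)

/-- A silent run of `b` reaches the session operation or spawn `o`. -/
inductive Head (C : Constraints) : Beh → Beh → Prop
  | op {o} : o.IsSessionOp → Head C o o
  | spawn (b) : Head C (.spawn b) (.spawn b)
  | seqLeft {b₁ b₂ o} : Head C b₁ o → Head C (.seq b₁ b₂) o
  | seqRight {b₁ b₂ o} : Silent C b₁ → Head C b₂ o → Head C (.seq b₁ b₂) o
  | plusLeft {b₁ b₂ o} : Head C b₁ o → Head C (.plus b₁ b₂) o
  | plusRight {b₁ b₂ o} : Head C b₂ o → Head C (.plus b₁ b₂) o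
  | beta {b β o} : BehSub C b (.var β) → Head C b o → Head C (.var β) o
  | unfold {b β₀ β o} : BehSub C (.recur b β₀) (.var β) → Head C b o → Head C (.var β) o

/-- A silent run of `b`, or of a behaviour that it spawns, reaches a session operation; the
number counts the rules used. -/
inductive Hit (C : Constraints) : ℕ → Beh → Prop
  | op {o} : o.IsSessionOp → Hit C 0 o
  | spawn {n b} : Hit C n b → Hit C (n + 1) (.spawn b)
  | seqLeft {n b₁ b₂} : Hit C n b₁ → Hit C (n + 1) (.seq b₁ b₂)
  | seqRight {n b₁ b₂} : Silent C b₁ → Hit C n b₂ → Hit C (n + 1) (.seq b₁ b₂)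
  | plusLeft {n b₁ b₂} : Hit C n b₁ → Hit C (n + 1) (.plus b₁ b₂)
  | plusRight {n b₁ b₂} : Hit C n b₂ → Hit C (n + 1) (.plus b₁ b₂)
  | beta {n b β} : BehSub C b (.var β) → Hit C n b → Hit C (n + 1) (.var β)
  | unfold {n b β₀ β} : BehSub C (.recur b β₀) (.var β) → Hit C n b → Hit C (n + 1) (.var β)

theorem Head.hit {C : Constraints} {b o : Beh} (h : Head C b o) (ho : ∃ n, Hit C n o) :
    ∃ n, Hit C n b := by
  induction h with
  | op _ => exact ho
  | spawn _ => exact ho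
  | seqLeft _ ih => exact (ih ho).imp' _ fun _ => .seqLeft
  | seqRight hf _ ih => exact (ih ho).imp' _ fun _ => .seqRight hf
  | plusLeft _ ih => exact (ih ho).imp' _ fun _ => .plusLeft
  | plusRight _ ih => exact (ih ho).imp' _ fun _ => .plusRight
  | beta hb _ ih => exact (ih ho).imp' _ fun _ => .beta hb
  | unfold hb _ ih => exact (ih ho).imp' _ fun _ => .unfold hb

/-- Every silent run of `b` is matched by one of `b'`. -/
structure Le (C : Constraints) (b b' : Beh) : Prop where
  fin : Silent C b → Silent C b'
  head : ∀ o, Head C b o → Head C b' o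

theorem Le.refl (C : Constraints) (b : Beh) : Le C b b := ⟨_root_.id, fun _ => _root_.id⟩

theorem Le.trans {C : Constraints} {b₁ b₂ b₃ : Beh} (h : Le C b₁ b₂) (h' : Le C b₂ b₃) :
    Le C b₁ b₃ := ⟨h'.fin ∘ h.fin, fun o => h'.head o ∘ h.head o⟩

theorem Le.seq_left {C : Constraints} {b₁ b₁' : Beh} (h : Le C b₁ b₁') (b₂ : Beh) :
    Le C (.seq b₁ b₂) (.seq b₁' b₂) where
  fin h' := by
    cases h' with
    | seq h₁ h₂ => exact .seq (h.fin h₁) h₂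
  head o h' := by
    cases h' with
    | op h => exact h.elim
    | seqLeft h₁ => exact .seqLeft (h.head o h₁)
    | seqRight h₁ h₂ => exact .seqRight (h.fin h₁) h₂

theorem Le.of_behSub {C : Constraints} {b : Beh} {β : ℕ} (h : BehSub C b (.var β)) :
    Le C b (.var β) := ⟨.beta h, fun _ => .beta h⟩

theorem Le.of_unfold {C : Constraints} {b : Beh} {β₀ β : ℕ}
    (h : BehSub C (.recur b β₀) (.var β)) : Le C b (.var β) := ⟨.unfold h, fun _ => .unfold h⟩

theorem Le.seq_of_fin {C : Constraints} {b₁ : Beh} (h : Silent C b₁) (b₂ : Beh) :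
    Le C b₂ (.seq b₁ b₂) := ⟨.seq h, fun _ => .seqRight h⟩

theorem Le.plus_left (C : Constraints) (b₁ b₂ : Beh) : Le C b₁ (.plus b₁ b₂) :=
  ⟨.plusLeft, fun _ => .plusLeft⟩

theorem Le.plus_right (C : Constraints) (b₁ b₂ : Beh) : Le C b₂ (.plus b₁ b₂) :=
  ⟨.plusRight, fun _ => .plusRight⟩

theorem Le.tau_of_fin {C : Constraints} {b : Beh} (h : Silent C b) : Le C .tau b where
  fin _ := h
  head _ h' := by
    cases h' with
    | op h => exact h.elim

theorem Le.seq_tau_left (C : Constraints) (b : Beh) : Le C (.seq .tau b) b where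
  fin h := by
    cases h with
    | seq _ h => exact h
  head o h := by
    cases h with
    | op h => exact h.elim
    | seqLeft h =>
      cases h with
      | op h => exact h.elim
    | seqRight _ h => exact h

/-! ### Cutting recursive inclusions -/

/-- Recursive behaviours are included in their own variables only, and as the only inclusion. -/
structure Compact (C : Constraints) : Prop where
  var : ∀ b β β', Constraint.behSub (.recur b β) β' ∈ C → β = β'
  unique : ∀ b b' β, Constraint.behSub (.recur b β) β ∈ C →
    Constraint.behSub b' β ∈ C → b' = .recur b β

theorem WellFormed.compact {C : Constraints} (h : WellFormed C) : Compact C :=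
  ⟨h.compactVar, h.compactUnique⟩

theorem Constraints.behSub_mem_cut {C : Constraints} {b : Beh} {β β' : ℕ} :
    Constraint.behSub b β' ∈ C.cut β ↔
      (b = .tau ∧ β' = β) ∨ (Constraint.behSub b β' ∈ C ∧ β' ≠ β) := by
  simp [Constraints.cut]

theorem Compact.cut {C : Constraints} (h : Compact C) (β : ℕ) : Compact (C.cut β) where
  var b β₁ β₂ h' := by
    rcases Constraints.behSub_mem_cut.1 h' with h' | h'
    · exact absurd h'.1 (by simp)
    · exact h.var _ _ _ h'.1
  unique b b' β₁ h₁ h₂ := by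
    rcases Constraints.behSub_mem_cut.1 h₁ with h₁ | h₁
    · exact absurd h₁.1 (by simp)
    rcases Constraints.behSub_mem_cut.1 h₂ with h₂ | h₂
    · exact absurd h₂.2 h₁.2
    · exact h.unique _ _ _ h₁.1 h₂.1

theorem Compact.mem_of_behSub {C : Constraints} (h : Compact C) {b : Beh} {β β' : ℕ}
    (hb : BehSub C (.recur b β) (.var β')) : Constraint.behSub (.recur b β) β ∈ C := by
  rcases Relation.ReflTransGen.cases_head hb with hb | ⟨_, ⟨β₁, rfl, h₁⟩, -⟩
  · exact absurd hb (by simp)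
  · obtain rfl := h.var _ _ _ h₁
    exact h₁

/-- A recursive behaviour is not a variable, so it can only be the source of a chain. As it is the
only inclusion in `β`, cutting `β` affects just the chains that start from it. -/
theorem Compact.behSub_cut {C : Constraints} (h : Compact C) {b₀ : Beh} {β : ℕ}
    (hβ : Constraint.behSub (.recur b₀ β) β ∈ C) {b b' : Beh} (hb : BehSub C b b') :
    BehSub (C.cut β) b b' ∨ (b = .recur b₀ β ∧ BehSub (C.cut β) (.var β) b') := by
  induction hb using Relation.ReflTransGen.head_induction_on with
  | refl => exact .inl .refl
  | head h₁ _ ih =>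
    obtain ⟨β₁, rfl, h₁⟩ := h₁
    have ih := ih.resolve_right (by simp)
    by_cases he : β₁ = β
    · subst he
      exact .inr ⟨h.unique _ _ _ hβ h₁, ih⟩
    · exact .inl (.head ⟨β₁, rfl, Constraints.behSub_mem_cut.2 (.inr ⟨h₁, he⟩)⟩ ih)

/-- Where the run unfolds `rec_β b₀`, the new inclusion `τ ⊆ β` ends it at once. -/
theorem Compact.fin_cut {C : Constraints} (h : Compact C) {b₀ : Beh} {β : ℕ}
    (hβ : Constraint.behSub (.recur b₀ β) β ∈ C) {b : Beh} (hb : Silent C b) :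
    Silent (C.cut β) b := by
  have tauβ : ∀ {β'}, BehSub (C.cut β) (.var β) (.var β') → Silent (C.cut β) (.var β') := fun h' =>
    .beta (.head ⟨β, rfl, Constraints.behSub_mem_cut.2 (.inl ⟨rfl, rfl⟩)⟩ h') .tau
  induction hb with
  | tau => exact .tau
  | seq _ _ ih₁ ih₂ => exact .seq ih₁ ih₂
  | plusLeft _ ih => exact .plusLeft ih
  | plusRight _ ih => exact .plusRight ih
  | beta hs _ ih =>
    rcases h.behSub_cut hβ hs with hs | hs
    · exact .beta hs ih
    · exact tauβ hs.2
  | unfold hs _ ih =>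
    rcases h.behSub_cut hβ hs with hs | hs
    · exact .unfold hs ih
    · exact tauβ hs.2
  | spawn b => exact .spawn b

/-- Either the run avoids the recursive inclusion and survives the cut, or what follows the
unfolding is a strictly shorter run of the body `b₀`. -/
theorem Compact.hit_cut_or {C : Constraints} (h : Compact C) {b₀ : Beh} {β : ℕ}
    (hβ : Constraint.behSub (.recur b₀ β) β ∈ C) {n : ℕ} {b : Beh} (hb : Hit C n b) :
    (∃ m ≤ n, Hit (C.cut β) m b) ∨ ∃ m < n, Hit C m b₀ := by
  have lift : ∀ {n : ℕ} {b b' : Beh}, (∀ m, Hit (C.cut β) m b → Hit (C.cut β) (m + 1) b') →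
      ((∃ m ≤ n, Hit (C.cut β) m b) ∨ ∃ m < n, Hit C m b₀) →
      (∃ m ≤ n + 1, Hit (C.cut β) m b') ∨ ∃ m < n + 1, Hit C m b₀ := by
    rintro n b b' hm (⟨m, hn, h'⟩ | ⟨m, hn, h'⟩)
    · exact .inl ⟨m + 1, by omega, hm m h'⟩
    · exact .inr ⟨m, by omega, h'⟩
  induction hb with
  | op ho => exact .inl ⟨0, le_rfl, .op ho⟩
  | spawn _ ih => exact lift (fun _ => .spawn) ih
  | seqLeft _ ih => exact lift (fun _ => .seqLeft) ih
  | seqRight hf _ ih => exact lift (fun _ => .seqRight (h.fin_cut hβ hf)) ih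
  | plusLeft _ ih => exact lift (fun _ => .plusLeft) ih
  | plusRight _ ih => exact lift (fun _ => .plusRight) ih
  | beta hs hb ih =>
    rcases h.behSub_cut hβ hs with hs | ⟨rfl, -⟩
    · exact lift (fun _ => .beta hs) ih
    · cases hb with
      | op ho => exact ho.elim
  | @unfold n b β₀ β' hs hb ih =>
    rcases h.behSub_cut hβ hs with hs | ⟨he, -⟩
    · exact lift (fun _ => .unfold hs) ih
    · obtain ⟨rfl, rfl⟩ := Beh.recur.inj he
      exact .inr ⟨n, by omega, hb⟩

/-- Descent on the length of the run. The bound `m ≤ n` allows later inductions on the length to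
continue in the cut environment. -/
theorem Compact.hit_cut {C : Constraints} (h : Compact C) {b₀ : Beh} {β : ℕ}
    (hβ : Constraint.behSub (.recur b₀ β) β ∈ C) {n : ℕ} (hb : Hit C n b₀) :
    ∃ m ≤ n, Hit (C.cut β) m b₀ := by
  induction n using Nat.strong_induction_on with
  | _ n ih =>
    rcases h.hit_cut_or hβ hb with h' | ⟨m, hm, h'⟩
    · exact h'
    · obtain ⟨k, hk, h''⟩ := ih m hm h'
      exact ⟨k, by omega, h''⟩

/-! ### Abstract interpretation of silent runs -/

/-- `b; c₁; …; cₙ` for the list of the `cᵢ`. -/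
def Beh.plug : Beh → List Beh → Beh
  | b, [] => b
  | b, c :: cs => (Beh.seq b c).plug cs

theorem Beh.plug_ne_tau {b : Beh} (hb : b ≠ .tau) : ∀ cs : List Beh, b.plug cs ≠ .tau := by
  intro cs
  induction cs generalizing b with
  | nil => exact hb
  | cons c cs ih => exact ih (by simp)

theorem AStep.plug {R : Constraints → Beh → Prop} {C : Constraints} {Δ Δ' : Stack} {b b' : Beh}
    (h : AStep R C (Δ, b) (Δ', b')) (cs : List Beh) :
    AStep R C (Δ, b.plug cs) (Δ', b'.plug cs) := by
  induction cs generalizing b b' with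
  | nil => exact h
  | cons c cs ih => exact ih (.seq h)

/-- The frame on the top of the list, if any, is not finished. -/
def TopOpen (fs : List (ℕ × Sess)) : Prop := ∀ l gs, fs ≠ (l, .done) :: gs

/-- A finished top frame could be removed whatever the behaviour is, and `τ; c` could drop `τ`; with
both excluded, only `b` itself can move. -/
theorem AStep.of_plug {R : Constraints → Beh → Prop} {C : Constraints} {Δ : Stack} {b : Beh}
    (hΔ : TopOpen Δ.frames) (hb : b ≠ .tau) {cs : List Beh} {conf : Stack × Beh}
    (h : AStep R C (Δ, b.plug cs) conf) : ∃ conf', AStep R C (Δ, b) conf' := by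
  induction cs generalizing b with
  | nil => exact ⟨_, h⟩
  | cons c cs ih =>
    obtain ⟨_, h'⟩ := ih (by simp) h
    cases h' with
    | fin => exact absurd rfl (hΔ _ _)
    | seq h' => exact ⟨_, h'⟩
    | tau => exact absurd rfl hb

section Normalization

variable {R : Constraints → Beh → Prop} {C : Constraints} {Δ Δ' : Stack} {b b' : Beh}
  {cs : List Beh}

theorem NormalizesWith.step (h : NormalizesWith R C Δ b) (hs : AStep R C (Δ, b) (Δ', b')) :
    NormalizesWith R C Δ' b' := fun _ _ hr => h _ _ (.head hs hr)

/-- If `b` were stuck, the whole configuration would be stuck without being `τ`. -/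
theorem NormalizesWith.progress (h : NormalizesWith R C Δ (b.plug cs)) (hΔ : TopOpen Δ.frames)
    (hb : b ≠ .tau) : ∃ conf, AStep R C (Δ, b) conf := by
  by_contra hn
  refine Beh.plug_ne_tau hb cs (h _ _ .refl ?_).1
  rintro ⟨conf, hc⟩
  exact hn (hc.of_plug hΔ hb)

/-- Normalization forces a transition, and the only one available carries the claim as its premise.
-/
theorem NormalizesWith.recur {β : ℕ} (h : NormalizesWith R C Δ ((Beh.recur b β).plug cs))
    (hΔ : TopOpen Δ.frames) : R (C.cut β) b := by
  obtain ⟨_, hs⟩ := h.progress hΔ (by simp)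
  cases hs with
  | fin => exact absurd rfl (hΔ _ _)
  | recur h => exact h

theorem NormalizesWith.spawn (h : NormalizesWith R C Δ ((Beh.spawn b).plug cs))
    (hΔ : TopOpen Δ.frames) : R C b := by
  obtain ⟨_, hs⟩ := h.progress hΔ (by simp)
  cases hs with
  | fin => exact absurd rfl (hΔ _ _)
  | spawn h => exact h

/-- The run is simulated by transitions that leave the stack alone. Unfoldings and spawns collapse
to `τ` in one step, since otherwise the configuration would be stuck. -/
theorem NormalizesWith.plug_tau (hf : Silent C b) (h : NormalizesWith R C Δ (b.plug cs))
    (hΔ : TopOpen Δ.frames) : NormalizesWith R C Δ (Beh.tau.plug cs) := by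
  induction hf generalizing cs with
  | tau => exact h
  | @seq b₁ b₂ _ _ ih₁ ih₂ => exact ih₂ ((ih₁ (cs := b₂ :: cs) h).step (AStep.tau.plug cs))
  | plusLeft _ ih => exact ih (h.step (AStep.plusLeft.plug cs))
  | plusRight _ ih => exact ih (h.step (AStep.plusRight.plug cs))
  | beta hs _ ih => exact ih (h.step ((AStep.beta hs).plug cs))
  | unfold hs _ _ =>
    have h' := h.step ((AStep.beta hs).plug cs)
    exact h'.step ((AStep.recur (h'.recur hΔ)).plug cs)
  | spawn b => exact h.step ((AStep.spawn (h.spawn hΔ)).plug cs)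

/-- Induction on the length of the run, with the environment varying. No session operation can move
on an empty stack, and the bodies of spawns and recursions are themselves checked on the empty stack
through `R`. -/
theorem NormalizesWith.not_hit (hR : ∀ C' b', R C' b' → NormalizesWith R C' Stack.empty b')
    (hC : Compact C) {n : ℕ} (hΔ : Δ.frames = []) (h : NormalizesWith R C Δ (b.plug cs)) :
    ¬ Hit C n b := by
  have top : ∀ {Δ : Stack}, Δ.frames = [] → TopOpen Δ.frames := by
    intro Δ h l gs
    simp [h]
  induction n using Nat.strong_induction_on generalizing C Δ b cs with
  | _ n ih =>
    intro hb
    cases hb with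
    | op ho =>
      obtain ⟨conf, hs⟩ := h.progress (top hΔ) (by rintro rfl; exact ho)
      cases hs <;> first | exact ho | simp at hΔ
    | spawn hb => exact ih _ (Nat.lt_succ_self _) hC rfl (cs := []) (hR _ _ (h.spawn (top hΔ))) hb
    | @seqLeft n b₁ b₂ hb => exact ih _ (Nat.lt_succ_self _) hC hΔ (cs := b₂ :: cs) h hb
    | @seqRight n b₁ b₂ hf hb =>
      exact ih _ (Nat.lt_succ_self _) hC hΔ
        ((NormalizesWith.plug_tau (cs := b₂ :: cs) hf h (top hΔ)).step (AStep.tau.plug cs)) hb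
    | plusLeft hb => exact ih _ (Nat.lt_succ_self _) hC hΔ (h.step (AStep.plusLeft.plug cs)) hb
    | plusRight hb => exact ih _ (Nat.lt_succ_self _) hC hΔ (h.step (AStep.plusRight.plug cs)) hb
    | beta hs hb => exact ih _ (Nat.lt_succ_self _) hC hΔ (h.step ((AStep.beta hs).plug cs)) hb
    | unfold hs hb =>
      have hr := (h.step ((AStep.beta hs).plug cs)).recur (top hΔ)
      -- The body was checked in the cut environment, so the hit is moved there without growing.
      obtain ⟨m, hm, hb'⟩ := hC.hit_cut (hC.mem_of_behSub hs) hb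
      exact ih m (by omega) (hC.cut _) rfl (cs := []) (hR _ _ hr) hb'

/-- Transitions follow the run up to its head, except at an unfolding. There the body was checked on
the empty stack, so no head from which a session operation can be hit lies behind it. -/
theorem NormalizesWith.head (hR : ∀ C' b', R C' b' → NormalizesWith R C' Stack.empty b')
    (hC : Compact C) (hΔ : TopOpen Δ.frames) {o : Beh} (ho : Head C b o)
    (h : NormalizesWith R C Δ (b.plug cs)) :
    (o.IsSessionOp → ∃ conf, AStep R C (Δ, o) conf) ∧
      ∀ b₁, o = .spawn b₁ → ∀ n, ¬ Hit C n b₁ := by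
  induction ho generalizing cs with
  | op ho =>
    refine ⟨fun _ => h.progress hΔ (by rintro rfl; exact ho), ?_⟩
    rintro b₁ rfl
    exact ho.elim
  | spawn b =>
    refine ⟨fun h => h.elim, ?_⟩
    rintro b₁ he n
    cases he
    exact NormalizesWith.not_hit (cs := []) hR hC rfl (hR _ _ (h.spawn hΔ))
  | @seqLeft b₁ b₂ _ _ ih => exact ih (cs := b₂ :: cs) h
  | @seqRight b₁ b₂ _ hf _ ih =>
    exact ih ((NormalizesWith.plug_tau (cs := b₂ :: cs) hf h hΔ).step (AStep.tau.plug cs))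
  | plusLeft _ ih => exact ih (h.step (AStep.plusLeft.plug cs))
  | plusRight _ ih => exact ih (h.step (AStep.plusRight.plug cs))
  | beta hs _ ih => exact ih (h.step ((AStep.beta hs).plug cs))
  | @unfold b β₀ β o hs hb _ =>
    have hr := (h.step ((AStep.beta hs).plug cs)).recur hΔ
    have hn : ∀ n, ¬ Hit C n o := by
      intro n hn
      obtain ⟨k, hk⟩ := hb.hit ⟨n, hn⟩
      obtain ⟨m, -, hb'⟩ := hC.hit_cut (hC.mem_of_behSub hs) hk
      exact NormalizesWith.not_hit (cs := []) hR (hC.cut _) rfl (hR _ _ hr) hb'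
    refine ⟨fun ho => (hn 0 (.op ho)).elim, ?_⟩
    rintro b₁ rfl n hb₁
    exact hn _ (.spawn hb₁)

end Normalization

/-! ### Agreement of silent runs with a stack -/

/-- Remove the finished frames from the top. -/
def stripDone : List (ℕ × Sess) → List (ℕ × Sess)
  | (_, .done) :: fs => stripDone fs
  | fs => fs

theorem stripDone_topOpen : ∀ fs : List (ℕ × Sess), TopOpen (stripDone fs)
  | [] => by simp [TopOpen, stripDone]
  | (l, η) :: fs => by
    cases η <;> simp only [stripDone]
    · exact stripDone_topOpen fs
    all_goals simp [TopOpen]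

/-- The silent runs of `b` agree with a stack with the given frames. -/
structure Safe (C : Constraints) (fs : List (ℕ × Sess)) (b : Beh) : Prop where
  op : ∀ o, Head C b o → o.IsSessionOp →
    ∃ (R : Constraints → Beh → Prop) (u : Finset ℕ) (conf : Stack × Beh),
      AStep R C (⟨stripDone fs, u⟩, o) conf
  spawn : ∀ b₁, Head C b (.spawn b₁) → ∀ n, ¬ Hit C n b₁
  fin : Silent C b → stripDone fs = []

theorem Safe.of_normalizes {C : Constraints} (hC : Compact C) {Δ : Stack} {b : Beh}
    (h : Normalizes C Δ b) : Safe C Δ.frames b := by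
  obtain ⟨R, hR, h⟩ := h
  -- Each removal of a finished frame adds its label to the used ones, hence the unspecified `u`.
  obtain ⟨u, h⟩ : ∃ u, NormalizesWith R C ⟨stripDone Δ.frames, u⟩ b := by
    obtain ⟨fs, u⟩ := Δ
    induction fs generalizing u with
    | nil => exact ⟨u, h⟩
    | cons f fs ih =>
      obtain ⟨l, η⟩ := f
      cases η <;> first | exact ⟨u, h⟩ | exact ih _ (h.step .fin)
  have hΔ := stripDone_topOpen Δ.frames
  refine ⟨fun o ho hop => ?_, fun b₁ ho => ?_, fun hf => ?_⟩
  · obtain ⟨conf, hs⟩ := (NormalizesWith.head (cs := []) hR hC hΔ ho h).1 hop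
    exact ⟨R, u, conf, hs⟩
  · exact (NormalizesWith.head (cs := []) hR hC hΔ ho h).2 b₁ rfl
  · refine (NormalizesWith.plug_tau (cs := []) hf h hΔ _ _ .refl ?_).2
    generalize stripDone Δ.frames = fs at hΔ
    rintro ⟨conf, hs⟩
    cases hs with
    | fin => exact absurd rfl (hΔ _ _)

theorem Safe.of_not_hit {C : Constraints} {b : Beh} (h : ∀ n, ¬ Hit C n b) : Safe C [] b where
  op o ho hop := by
    obtain ⟨n, hn⟩ := ho.hit ⟨0, .op hop⟩
    exact (h n hn).elim
  spawn b₁ ho n hn := by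
    obtain ⟨m, hm⟩ := ho.hit ⟨n + 1, .spawn hn⟩
    exact h m hm
  fin _ := rfl

/-! ### A typing judgement without schemas -/

/-- Type environments that assign sets of monotypes to variables. -/
abbrev TyEnv := ℕ → Set Ty

/-- Typing under a fixed constraint environment. A `let`-bound expression has all types of a set,
and subsumption compares the silent runs of the effects. -/
inductive HasTy (C : Constraints) : TyEnv → Expr → Ty → Beh → Prop
  | var {Γ x T} : T ∈ Γ x → HasTy C Γ (.var x) T .tau
  | const {Γ} (σ : Subst) (k : Const) : Sat C σ k.typeOf.constr →
      HasTy C Γ (.const k) (k.typeOf.body.subst σ) .tau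
  | endp {Γ p l ρ} : RegEq C (.var ρ) (.lab l) → HasTy C Γ (.endp p l) (.ses ρ) .tau
  | pair {Γ e₁ e₂ T₁ T₂ b₁ b₂} : HasTy C Γ e₁ T₁ b₁ → HasTy C Γ e₂ T₂ b₂ →
      HasTy C Γ (.pair e₁ e₂) (.pair T₁ T₂) (.seq b₁ b₂)
  | letE {Γ x e₁ e₂ T b₁ b₂} (S : Set Ty) : (∀ U ∈ S, HasTy C Γ e₁ U b₁) →
      HasTy C (Function.update Γ x S) e₂ T b₂ → (S.Nonempty ∨ IsValue e₁ ∧ b₁ = .tau) →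
      HasTy C Γ (.letE x e₁ e₂) T (.seq b₁ b₂)
  | ite {Γ e₁ e₂ e₃ T b₁ b₂ b₃} : HasTy C Γ e₁ .bool b₁ → HasTy C Γ e₂ T b₂ →
      HasTy C Γ e₃ T b₃ → HasTy C Γ (.ite e₁ e₂ e₃) T (.seq b₁ (.plus b₂ b₃))
  | app {Γ e₁ e₂ T T' β b₁ b₂} : HasTy C Γ e₁ (.fn T' β T) b₁ → HasTy C Γ e₂ T' b₂ →
      HasTy C Γ (.app e₁ e₂) T (.seq (.seq b₁ b₂) (.var β))
  | fn {Γ x e T T' β} : HasTy C (Function.update Γ x {T}) e T' (.var β) →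
      HasTy C Γ (.fn x e) (.fn T β T') .tau
  | fix {Γ f x e T T' b β} :
      HasTy C (Function.update (Function.update Γ f {.fn T β T'}) x {T}) e T' b →
      BehSub C (.recur b β) (.var β) → HasTy C Γ (.fix f x e) (.fn T β T') .tau
  | spawn {Γ e β b} : HasTy C Γ e (.fn .unit β .unit) b →
      HasTy C Γ (.spawn e) .unit (.seq b (.spawn (.var β)))
  | branch {Γ e ρ b I T} {es : {i // i ∈ I} → Expr} {bs : {i // i ∈ I} → Beh} :
      HasTy C Γ e (.ses ρ) b → (∀ i, HasTy C Γ (es i) T (bs i)) →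
      HasTy C Γ (.branch e I es) T (.seq b (.offer ρ I bs))
  | sub {Γ e T T' b b'} : HasTy C Γ e T b → TySub C T T' → Le C b b' → HasTy C Γ e T' b'

/-- The sets of monotypes that the schemas of an environment stand for. -/
def Env.instances (C : Constraints) (σ : Subst) (Γ : Env) : TyEnv := fun x =>
  {T | ∃ S, Γ x = some S ∧ T ∈ S.instances C σ}

theorem Env.instances_extend (C : Constraints) (σ : Subst) (Γ : Env) (x : ℕ) (S : Scheme) :
    (Γ.extend x S).instances C σ =
      Function.update (Γ.instances C σ) x (S.instances C σ) := by
  funext y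
  by_cases h : y = x
  · subst h
    simp [Env.instances, Env.extend]
  · simp [Env.instances, Env.extend, h]

theorem Env.instances_congr {C : Constraints} {σ τ : Subst} {Γ : Env}
    (h : ∀ g ∈ Γ.fv, σ.AgreeAt τ g) : Γ.instances C σ = Γ.instances C τ := by
  funext x
  ext T
  constructor <;> rintro ⟨S, hS, hT⟩
  · exact ⟨S, hS, Scheme.instances_subset (fun g hg => h g ⟨x, S, hS, hg⟩) hT⟩
  · exact ⟨S, hS, Scheme.instances_subset (fun g hg => (h g ⟨x, S, hS, hg⟩).symm) hT⟩

/-- This provides the side condition of `HasTy.letE`. Generalised schemas are solvable by rule; only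
variables and constants may have a schema without instances, and they are values with effect `τ`. -/
theorem Typing.nonempty_or_value {C D : Constraints} {Γ : Env} {e : Expr} {S : Scheme} {b : Beh}
    {σ : Subst} (hσ : Sat C σ D) (h : Typing D Γ e S b) :
    (S.instances C σ).Nonempty ∨ IsValue e ∧ b.subst σ = .tau := by
  have mono : ∀ T, ((Scheme.mono T).instances C σ).Nonempty := fun T => by
    simp [Scheme.instances_mono]
  cases h with
  | var _ => exact .inr ⟨.var _, rfl⟩
  | const k => exact .inr ⟨.const k, rfl⟩
  | gen _ _ _ h =>
    obtain ⟨σ₀, h⟩ := h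
    exact .inl ⟨_, σ₀.comp σ, fun g hg => h.1.comp_agree hg, h.sat_comp hσ, rfl⟩
  | _ => exact .inl (mono _)

/-- The induction quantifies over `σ`: generalisation is met by reading one derivation at every
instance, and instantiation by composing substitutions. -/
theorem Typing.hasTy {C D : Constraints} {Γ : Env} {e : Expr} {S : Scheme} {b : Beh}
    (h : Typing D Γ e S b) {σ : Subst} (hσ : Sat C σ D) {T : Ty} (hT : T ∈ S.instances C σ) :
    HasTy C (Γ.instances C σ) e T (b.subst σ) := by
  induction h generalizing σ T with
  | var h => exact .var ⟨_, h, hT⟩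
  | const k =>
    obtain ⟨σ', -, hs, rfl⟩ := hT
    exact .const σ' k hs
  | endp h =>
    rw [Scheme.instances_mono] at hT
    obtain rfl := hT
    exact .endp (RegEq.subst hσ h)
  | pair _ _ ih₁ ih₂ =>
    rw [Scheme.instances_mono] at hT
    obtain rfl := hT
    simp only [Scheme.instances_mono] at ih₁ ih₂
    exact .pair (ih₁ hσ rfl) (ih₂ hσ rfl)
  | letE h₁ _ ih₁ ih₂ =>
    refine .letE _ (fun U hU => ih₁ hσ hU) ?_ (h₁.nonempty_or_value hσ)
    rw [← Env.instances_extend]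
    exact ih₂ hσ hT
  | ite _ _ _ ih₁ ih₂ ih₃ =>
    exact .ite (ih₁ hσ (by simp [Scheme.instances_mono, Ty.subst])) (ih₂ hσ hT) (ih₃ hσ hT)
  | app _ _ ih₁ ih₂ =>
    rw [Scheme.instances_mono] at hT
    obtain rfl := hT
    simp only [Scheme.instances_mono] at ih₁ ih₂
    exact .app (ih₁ hσ rfl) (ih₂ hσ rfl)
  | fn _ ih =>
    rw [Scheme.instances_mono] at hT
    obtain rfl := hT
    simp only [Scheme.instances_mono, Env.instances_extend] at ih
    exact .fn (ih hσ rfl)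
  | fix _ _ _ hb ih =>
    rw [Scheme.instances_mono] at hT
    obtain rfl := hT
    simp only [Scheme.instances_mono, Env.instances_extend] at ih
    exact .fix (ih hσ rfl) (BehSub.subst hσ hb)
  | spawn _ ih =>
    rw [Scheme.instances_mono] at hT
    obtain rfl := hT
    simp only [Scheme.instances_mono] at ih
    exact .spawn (ih hσ rfl)
  | branch _ _ ih ihs =>
    simp only [Scheme.instances_mono] at ih
    exact .branch (ih hσ rfl) fun i => ihs i hσ hT
  | sub _ hsub hb ih =>
    rw [Scheme.instances_mono] at hT
    obtain rfl := hT
    simp only [Scheme.instances_mono] at ih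
    exact .sub (ih hσ rfl) (TySub.subst hσ hsub) (.of_behSub (BehSub.subst hσ hb))
  | @inst D Γ e S b σ₀ _ hs ih =>
    rw [Scheme.instances_mono] at hT
    obtain rfl := hT
    exact ih hσ ⟨σ₀.comp σ, fun g hg => hs.1.comp_agree hg, hs.sat_comp hσ,
      (Ty.subst_comp _ _ _).symm⟩
  | @gen D Γ e γ C₀ T₀ b _ hγ _ _ ih =>
    obtain ⟨σ', hag, hs, rfl⟩ := hT
    -- The generalised variables are not free in `b`, `Γ` or `D`, so `σ'` may replace `σ` there.
    have hb : b.subst σ = b.subst σ' :=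
      Beh.subst_congr fun g hg => (hag g fun h => (hγ g h).2.2 hg).symm
    have hΓ : Γ.instances C σ = Γ.instances C σ' :=
      Env.instances_congr fun g hg => (hag g fun h => (hγ g h).1 hg).symm
    have hD : Sat C σ' D := hσ.congr fun g hg => (hag g fun h => (hγ g h).2.1 hg).symm
    rw [hb, hΓ]
    refine ih (fun c hc => ?_) (by rw [Scheme.instances_mono]; rfl)
    rcases List.mem_append.1 hc with hc | hc
    exacts [hD c hc, hs c hc]

theorem Sat.refl (C : Constraints) : Sat C (Subst.ofSes Sess.var) C := by
  intro c hc
  cases c with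
  | tySub T T' =>
    simp only [Constraint.subst, Ty.subst_var]
    exact .ax hc
  | behSub b β =>
    simp only [Constraint.subst, Beh.subst_var]
    exact .single ⟨β, rfl, hc⟩
  | region ρ r =>
    have hr : r.subst (Subst.ofSes Sess.var) = r := by cases r <;> rfl
    simp only [Constraint.subst, hr]
    exact .rel _ _ ⟨ρ, rfl, hc⟩
  | _ => trivial

theorem Typing.hasTy_closed {C : Constraints} {e : Expr} {T : Ty} {b : Beh}
    (h : Typing C Env.empty e (.mono T) b) : HasTy C (fun _ => ∅) e T b := by
  have h := h.hasTy (Sat.refl C) (T := T) (by simp [Scheme.instances_mono, Ty.subst_var])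
  rw [Beh.subst_var] at h
  convert h using 1
  funext x
  simp [Env.instances, Env.empty]

/-! ### Weakening and substitution -/

theorem TyEnv.update_subset {Γ Γ' : TyEnv} {p : ℕ → Prop} (h : ∀ y, p y → Γ y ⊆ Γ' y)
    (x : ℕ) (S : Set Ty) (y : ℕ) (hy : p y ∨ y = x) :
    Function.update Γ x S y ⊆ Function.update Γ' x S y := by
  by_cases hx : y = x
  · subst hx
    simp
  · simpa [hx] using h y (hy.resolve_right hx)

theorem HasTy.weaken {C : Constraints} {Γ Γ' : TyEnv} {e : Expr} {T : Ty} {b : Beh}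
    (h : HasTy C Γ e T b) (hΓ : ∀ y, Γ y ⊆ Γ' y) : HasTy C Γ' e T b := by
  have upd : ∀ {Γ Γ' : TyEnv}, (∀ y, Γ y ⊆ Γ' y) → ∀ x S y,
      Function.update Γ x S y ⊆ Function.update Γ' x S y := fun h x S y =>
    TyEnv.update_subset (p := fun _ => True) (fun y _ => h y) x S y (.inl trivial)
  induction h generalizing Γ' with
  | var h => exact .var (hΓ _ h)
  | const σ k h => exact .const σ k h
  | endp h => exact .endp h
  | pair _ _ ih₁ ih₂ => exact .pair (ih₁ hΓ) (ih₂ hΓ)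
  | letE S _ _ hS ih₁ ih₂ => exact .letE S (fun U hU => ih₁ U hU hΓ) (ih₂ (upd hΓ _ _)) hS
  | ite _ _ _ ih₁ ih₂ ih₃ => exact .ite (ih₁ hΓ) (ih₂ hΓ) (ih₃ hΓ)
  | app _ _ ih₁ ih₂ => exact .app (ih₁ hΓ) (ih₂ hΓ)
  | fn _ ih => exact .fn (ih (upd hΓ _ _))
  | fix _ hb ih => exact .fix (ih (upd (upd hΓ _ _) _ _)) hb
  | spawn _ ih => exact .spawn (ih hΓ)
  | branch _ _ ih ihs => exact .branch (ih hΓ) fun i => ihs i hΓ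
  | sub _ hs hb ih => exact .sub (ih hΓ) hs hb

theorem IsValue.subst {v w : Expr} {x : ℕ} (hv : IsValue v) (hw : IsValue w) :
    IsValue (v.subst x w) := by
  induction hv with
  | var y =>
    simp only [Expr.subst]
    split
    exacts [hw, .var _]
  | const k => exact .const k
  | endp p l => exact .endp p l
  | pair _ _ ih₁ ih₂ => exact .pair ih₁ ih₂
  | fn y e =>
    simp only [Expr.subst]
    split <;> exact .fn _ _
  | fix f y e =>
    simp only [Expr.subst]
    split <;> exact .fix _ _ _

/-- The value is typed in the empty environment, so its typing weakens into any scope it is put in.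
-/
theorem HasTy.subst {C : Constraints} {Γ Γ' : TyEnv} {e v : Expr} {T : Ty} {b : Beh} {x : ℕ}
    (h : HasTy C Γ e T b) (hv : IsValue v) (hΓ : ∀ y, y ≠ x → Γ y ⊆ Γ' y)
    (hx : ∀ U ∈ Γ x, HasTy C (fun _ => ∅) v U .tau) : HasTy C Γ' (e.subst x v) T b := by
  have upd : ∀ {Γ Γ' : TyEnv}, (∀ y, y ≠ x → Γ y ⊆ Γ' y) → ∀ z S y, y ≠ x →
      Function.update Γ z S y ⊆ Function.update Γ' z S y := fun h z S y hy =>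
    TyEnv.update_subset h z S y (.inl hy)
  have updx : ∀ {Γ Γ' : TyEnv}, (∀ y, y ≠ x → Γ y ⊆ Γ' y) → ∀ S y,
      Function.update Γ x S y ⊆ Function.update Γ' x S y := fun h S y =>
    TyEnv.update_subset h x S y (Decidable.or_iff_not_imp_right.2 _root_.id)
  have updv : ∀ {Γ : TyEnv} {z : ℕ} {S : Set Ty}, z ≠ x →
      (∀ U ∈ Γ x, HasTy C (fun _ => ∅) v U .tau) →
      ∀ U ∈ Function.update Γ z S x, HasTy C (fun _ => ∅) v U .tau := by
    intro Γ z S hz h U hU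
    rw [Function.update_of_ne (Ne.symm hz)] at hU
    exact h U hU
  induction h generalizing Γ' with
  | @var Γ y T h =>
    simp only [Expr.subst]
    split
    · rename_i he
      subst he
      exact (hx _ h).weaken fun _ => Set.empty_subset _
    · rename_i he
      exact .var (hΓ _ he h)
  | const σ k h => exact .const σ k h
  | endp h => exact .endp h
  | pair _ _ ih₁ ih₂ => exact .pair (ih₁ hΓ hx) (ih₂ hΓ hx)
  | @letE Γ y e₁ e₂ T b₁ b₂ S _ h₂ hS ih₁ ih₂ =>
    refine .letE S (fun U hU => ih₁ U hU hΓ hx) ?_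
      (hS.imp_right fun h => ⟨h.1.subst hv, h.2⟩)
    split
    · rename_i he
      subst he
      exact h₂.weaken (updx hΓ S)
    · rename_i he
      exact ih₂ (upd hΓ y S) (updv he hx)
  | ite _ _ _ ih₁ ih₂ ih₃ => exact .ite (ih₁ hΓ hx) (ih₂ hΓ hx) (ih₃ hΓ hx)
  | app _ _ ih₁ ih₂ => exact .app (ih₁ hΓ hx) (ih₂ hΓ hx)
  | @fn Γ y e T T' β h ih =>
    simp only [Expr.subst]
    split
    · rename_i he
      subst he
      exact .fn (h.weaken (updx hΓ _))
    · rename_i he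
      exact .fn (ih (upd hΓ y _) (updv he hx))
  | @fix Γ f y e T T' b β h hb ih =>
    simp only [Expr.subst]
    split
    · rename_i he
      refine .fix (h.weaken fun z => ?_) hb
      -- After `f` is bound the environments can disagree only at `x`, and only if `f ≠ x`; in that
      -- case `y = x`, and binding `y` settles it.
      refine TyEnv.update_subset (p := fun z => z ≠ x ∨ z = f) (fun z hz => ?_) y _ z ?_
      · exact TyEnv.update_subset hΓ f _ z hz
      · rcases he with rfl | rfl
        · exact .inl (Decidable.or_iff_not_imp_right.2 _root_.id)
        · by_cases hz : z = y
          exacts [.inr hz, .inl (.inl hz)]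
    · rename_i he
      rw [not_or] at he
      exact .fix (ih (upd (upd hΓ f _) y _) (updv he.2 (updv he.1 hx))) hb
  | spawn _ ih => exact .spawn (ih hΓ hx)
  | branch _ _ ih ihs => exact .branch (ih hΓ hx) fun i => ihs i hΓ hx
  | sub _ hs hb ih => exact .sub (ih hΓ hx) hs hb

theorem HasTy.subst_update {C : Constraints} {Γ : TyEnv} {e v : Expr} {T : Ty} {b : Beh} {x : ℕ}
    {S : Set Ty} (h : HasTy C (Function.update Γ x S) e T b) (hv : IsValue v)
    (hS : ∀ U ∈ S, HasTy C (fun _ => ∅) v U .tau) : HasTy C Γ (e.subst x v) T b :=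
  h.subst hv (fun y hy => by rw [Function.update_of_ne hy]) (by simpa using hS)

/-! ### Inversion -/

section Inversion

variable {C : Constraints} {Γ : TyEnv} {T : Ty} {b : Beh}

/-- Silence of value effects is what allows evaluated subexpressions to be skipped in a run; the
typing with `τ` is what substitution requires. -/
theorem HasTy.value {v : Expr} (h : HasTy C Γ v T b) (hv : IsValue v) :
    Silent C b ∧ HasTy C Γ v T .tau := by
  induction h with
  | var h => exact ⟨.tau, .var h⟩
  | const σ k h => exact ⟨.tau, .const σ k h⟩
  | endp h => exact ⟨.tau, .endp h⟩
  | pair _ _ ih₁ ih₂ =>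
    cases hv with
    | pair hv₁ hv₂ =>
      exact ⟨.seq (ih₁ hv₁).1 (ih₂ hv₂).1,
        .sub (.pair (ih₁ hv₁).2 (ih₂ hv₂).2) (.refl _) (.seq_tau_left C .tau)⟩
  | fn h => exact ⟨.tau, .fn h⟩
  | fix h hb => exact ⟨.tau, .fix h hb⟩
  | sub _ hs hb ih => exact ⟨hb.fin (ih hv).1, .sub (ih hv).2 hs (.refl _ _)⟩
  | _ => nomatch hv

theorem HasTy.inv_const {k : Const} (h : HasTy C Γ (.const k) T b) :
    ∃ σ, Sat C σ k.typeOf.constr ∧ TySub C (k.typeOf.body.subst σ) T := by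
  generalize he : Expr.const k = e at h
  induction h with
  | const σ k h =>
    cases he
    exact ⟨σ, h, .refl _⟩
  | sub _ hs _ ih =>
    obtain ⟨σ, h, h'⟩ := ih he
    exact ⟨σ, h, h'.trans hs⟩
  | _ => nomatch he

theorem HasTy.inv_endp {p : Endpoint} {l : ℕ} (h : HasTy C Γ (.endp p l) T b) :
    ∃ ρ, RegEq C (.var ρ) (.lab l) ∧ TySub C (.ses ρ) T := by
  generalize he : Expr.endp p l = e at h
  induction h with
  | endp h =>
    cases he
    exact ⟨_, h, .refl _⟩
  | sub _ hs _ ih =>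
    obtain ⟨ρ, h, h'⟩ := ih he
    exact ⟨ρ, h, h'.trans hs⟩
  | _ => nomatch he

theorem HasTy.inv_pair {e₁ e₂ : Expr} (h : HasTy C Γ (.pair e₁ e₂) T b) :
    ∃ T₁ T₂ b₁ b₂, HasTy C Γ e₁ T₁ b₁ ∧ HasTy C Γ e₂ T₂ b₂ ∧ TySub C (.pair T₁ T₂) T ∧
      Le C (.seq b₁ b₂) b := by
  generalize he : Expr.pair e₁ e₂ = e at h
  induction h with
  | pair h₁ h₂ =>
    cases he
    exact ⟨_, _, _, _, h₁, h₂, .refl _, .refl _ _⟩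
  | sub _ hs hb ih =>
    obtain ⟨_, _, _, _, h₁, h₂, h₃, h₄⟩ := ih he
    exact ⟨_, _, _, _, h₁, h₂, h₃.trans hs, h₄.trans hb⟩
  | _ => nomatch he

theorem HasTy.inv_letE {x : ℕ} {e₁ e₂ : Expr} (h : HasTy C Γ (.letE x e₁ e₂) T b) :
    ∃ (S : Set Ty) (U : Ty) (b₁ b₂ : Beh), (∀ U ∈ S, HasTy C Γ e₁ U b₁) ∧
      HasTy C (Function.update Γ x S) e₂ U b₂ ∧ (S.Nonempty ∨ IsValue e₁ ∧ b₁ = .tau) ∧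
      TySub C U T ∧ Le C (.seq b₁ b₂) b := by
  generalize he : Expr.letE x e₁ e₂ = e at h
  induction h with
  | letE S h₁ h₂ h₃ =>
    cases he
    exact ⟨S, _, _, _, h₁, h₂, h₃, .refl _, .refl _ _⟩
  | sub _ hs hb ih =>
    obtain ⟨_, _, _, _, h₁, h₂, h₃, h₄, h₅⟩ := ih he
    exact ⟨_, _, _, _, h₁, h₂, h₃, h₄.trans hs, h₅.trans hb⟩
  | _ => nomatch he

theorem HasTy.inv_ite {e₁ e₂ e₃ : Expr} (h : HasTy C Γ (.ite e₁ e₂ e₃) T b) :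
    ∃ U b₁ b₂ b₃, HasTy C Γ e₁ .bool b₁ ∧ HasTy C Γ e₂ U b₂ ∧ HasTy C Γ e₃ U b₃ ∧
      TySub C U T ∧ Le C (.seq b₁ (.plus b₂ b₃)) b := by
  generalize he : Expr.ite e₁ e₂ e₃ = e at h
  induction h with
  | ite h₁ h₂ h₃ =>
    cases he
    exact ⟨_, _, _, _, h₁, h₂, h₃, .refl _, .refl _ _⟩
  | sub _ hs hb ih =>
    obtain ⟨_, _, _, _, h₁, h₂, h₃, h₄, h₅⟩ := ih he
    exact ⟨_, _, _, _, h₁, h₂, h₃, h₄.trans hs, h₅.trans hb⟩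
  | _ => nomatch he

theorem HasTy.inv_app {e₁ e₂ : Expr} (h : HasTy C Γ (.app e₁ e₂) T b) :
    ∃ U' β U b₁ b₂, HasTy C Γ e₁ (.fn U' β U) b₁ ∧ HasTy C Γ e₂ U' b₂ ∧ TySub C U T ∧
      Le C (.seq (.seq b₁ b₂) (.var β)) b := by
  generalize he : Expr.app e₁ e₂ = e at h
  induction h with
  | app h₁ h₂ =>
    cases he
    exact ⟨_, _, _, _, _, h₁, h₂, .refl _, .refl _ _⟩
  | sub _ hs hb ih =>
    obtain ⟨_, _, _, _, _, h₁, h₂, h₃, h₄⟩ := ih he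
    exact ⟨_, _, _, _, _, h₁, h₂, h₃.trans hs, h₄.trans hb⟩
  | _ => nomatch he

theorem HasTy.inv_fn {x : ℕ} {e : Expr} (h : HasTy C Γ (.fn x e) T b) :
    ∃ U β U', HasTy C (Function.update Γ x {U}) e U' (.var β) ∧ TySub C (.fn U β U') T := by
  generalize he : Expr.fn x e = e' at h
  induction h with
  | fn h =>
    cases he
    exact ⟨_, _, _, h, .refl _⟩
  | sub _ hs _ ih =>
    obtain ⟨_, _, _, h₁, h₂⟩ := ih he
    exact ⟨_, _, _, h₁, h₂.trans hs⟩
  | _ => nomatch he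

theorem HasTy.inv_fix {f x : ℕ} {e : Expr} (h : HasTy C Γ (.fix f x e) T b) :
    ∃ U β U' b₀, HasTy C (Function.update (Function.update Γ f {.fn U β U'}) x {U}) e U' b₀ ∧
      BehSub C (.recur b₀ β) (.var β) ∧ TySub C (.fn U β U') T := by
  generalize he : Expr.fix f x e = e' at h
  induction h with
  | fix h hb =>
    cases he
    exact ⟨_, _, _, _, h, hb, .refl _⟩
  | sub _ hs _ ih =>
    obtain ⟨_, _, _, _, h₁, h₂, h₃⟩ := ih he
    exact ⟨_, _, _, _, h₁, h₂, h₃.trans hs⟩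
  | _ => nomatch he

theorem HasTy.inv_spawn {e : Expr} (h : HasTy C Γ (.spawn e) T b) :
    ∃ β b₁, HasTy C Γ e (.fn .unit β .unit) b₁ ∧ TySub C .unit T ∧
      Le C (.seq b₁ (.spawn (.var β))) b := by
  generalize he : Expr.spawn e = e' at h
  induction h with
  | spawn h =>
    cases he
    exact ⟨_, _, h, .refl _, .refl _ _⟩
  | sub _ hs hb ih =>
    obtain ⟨_, _, h₁, h₂, h₃⟩ := ih he
    exact ⟨_, _, h₁, h₂.trans hs, h₃.trans hb⟩
  | _ => nomatch he

theorem HasTy.inv_branch {e : Expr} {I : Finset ℕ} {es : {i // i ∈ I} → Expr}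
    (h : HasTy C Γ (.branch e I es) T b) :
    ∃ ρ U b₁ bs, HasTy C Γ e (.ses ρ) b₁ ∧ (∀ i, HasTy C Γ (es i) U (bs i)) ∧ TySub C U T ∧
      Le C (.seq b₁ (.offer ρ I bs)) b := by
  generalize he : Expr.branch e I es = e' at h
  induction h with
  | branch h₁ h₂ =>
    cases he
    exact ⟨_, _, _, _, h₁, h₂, .refl _, .refl _ _⟩
  | sub _ hs hb ih =>
    obtain ⟨_, _, _, _, h₁, h₂, h₃, h₄⟩ := ih he
    exact ⟨_, _, _, _, h₁, h₂, h₃.trans hs, h₄.trans hb⟩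
  | _ => nomatch he

end Inversion

/-! ### Canonical forms -/

section Canonical

variable {C : Constraints} {b : Beh} {v : Expr}

theorem HasTy.not_var {x : ℕ} {T : Ty} : ¬ HasTy C (fun _ => ∅) (.var x) T b := by
  intro h
  generalize he : Expr.var x = e at h
  generalize hΓ : (fun _ => ∅ : TyEnv) = Γ at h
  induction h with
  | var h =>
    subst hΓ
    exact h
  | sub _ _ _ ih => exact ih he hΓ
  | _ => nomatch he

/-- Subsumption may use arbitrary inclusions from `C`; well-formedness keeps them from relating
distinct head constructors and lets them be split into components. -/
theorem HasTy.canonical_pair (hC : WellFormed C) {T₁ T₂ : Ty} (hv : IsValue v)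
    (h : HasTy C (fun _ => ∅) v (.pair T₁ T₂) b) :
    ∃ v₁ v₂, v = .pair v₁ v₂ ∧ IsValue v₁ ∧ IsValue v₂ ∧ HasTy C (fun _ => ∅) v₁ T₁ .tau ∧
      HasTy C (fun _ => ∅) v₂ T₂ .tau := by
  cases hv with
  | var x => exact absurd h HasTy.not_var
  | const k =>
    obtain ⟨σ, -, hs⟩ := h.inv_const
    cases k <;> exact (hC.typeConsistent _ _ hs).elim
  | endp p l =>
    obtain ⟨ρ, -, hs⟩ := h.inv_endp
    exact (hC.typeConsistent _ _ hs).elim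
  | pair hv₁ hv₂ =>
    obtain ⟨U₁, U₂, b₁, b₂, h₁, h₂, hs, -⟩ := h.inv_pair
    obtain ⟨hs₁, hs₂⟩ := hC.typeConsistent _ _ hs
    exact ⟨_, _, rfl, hv₁, hv₂, .sub (h₁.value hv₁).2 hs₁ (.refl _ _),
      .sub (h₂.value hv₂).2 hs₂ (.refl _ _)⟩
  | fn x e =>
    obtain ⟨_, _, _, -, hs⟩ := h.inv_fn
    exact (hC.typeConsistent _ _ hs).elim
  | fix f x e =>
    obtain ⟨_, _, _, _, -, -, hs⟩ := h.inv_fix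
    exact (hC.typeConsistent _ _ hs).elim

theorem HasTy.canonical_ses (hC : WellFormed C) {ρ : ℕ} (hv : IsValue v)
    (h : HasTy C (fun _ => ∅) v (.ses ρ) b) :
    ∃ p l, v = .endp p l ∧ RegEq C (.var ρ) (.lab l) := by
  cases hv with
  | var x => exact absurd h HasTy.not_var
  | const k =>
    obtain ⟨σ, -, hs⟩ := h.inv_const
    cases k <;> exact (hC.typeConsistent _ _ hs).elim
  | endp p l =>
    obtain ⟨ρ', hr, hs⟩ := h.inv_endp
    exact ⟨p, l, rfl, .trans _ _ _ (.symm _ _ (hC.typeConsistent _ _ hs)) hr⟩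
  | pair hv₁ hv₂ =>
    obtain ⟨_, _, _, _, -, -, hs, -⟩ := h.inv_pair
    exact (hC.typeConsistent _ _ hs).elim
  | fn x e =>
    obtain ⟨_, _, _, -, hs⟩ := h.inv_fn
    exact (hC.typeConsistent _ _ hs).elim
  | fix f x e =>
    obtain ⟨_, _, _, _, -, -, hs⟩ := h.inv_fix
    exact (hC.typeConsistent _ _ hs).elim

end Canonical

/-! ### Evaluation contexts -/

theorem ECtx.not_isValue_fill {r : Expr} (hr : ¬ IsValue r) (E : ECtx) :
    ¬ IsValue (E.fill r) := by
  induction E with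
  | hole => exact hr
  | pairL E e ih | pairR v hv E ih =>
    intro h
    cases h
    exact ih ‹_›
  | _ => exact nofun

/-- All types and effects of `r` must be preserved at once, because under a `let` the hole is typed
at a whole set of types. That `r` is not a value makes this set nonempty. -/
theorem HasTy.fill_congr {C : Constraints} {Γ : TyEnv} {r r' : Expr} (hr : ¬ IsValue r)
    (hrr : ∀ U b, HasTy C Γ r U b → HasTy C Γ r' U b) {E : ECtx} {T : Ty} {b : Beh}
    (h : HasTy C Γ (E.fill r) T b) : HasTy C Γ (E.fill r') T b := by
  induction E generalizing T b with
  | hole => exact hrr _ _ h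
  | pairL E e ih =>
    obtain ⟨_, _, _, _, h₁, h₂, hs, hb⟩ := h.inv_pair
    exact .sub (.pair (ih h₁) h₂) hs hb
  | pairR v hv E ih =>
    obtain ⟨_, _, _, _, h₁, h₂, hs, hb⟩ := h.inv_pair
    exact .sub (.pair h₁ (ih h₂)) hs hb
  | appL E e ih =>
    obtain ⟨_, _, _, _, _, h₁, h₂, hs, hb⟩ := h.inv_app
    exact .sub (.app (ih h₁) h₂) hs hb
  | appR v hv E ih =>
    obtain ⟨_, _, _, _, _, h₁, h₂, hs, hb⟩ := h.inv_app
    exact .sub (.app h₁ (ih h₂)) hs hb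
  | letE x E e ih =>
    obtain ⟨S, _, _, _, h₁, h₂, hS, hs, hb⟩ := h.inv_letE
    have hS := hS.resolve_right fun h => E.not_isValue_fill hr h.1
    exact .sub (.letE S (fun U hU => ih (h₁ U hU)) h₂ (.inl hS)) hs hb
  | ite E e₁ e₂ ih =>
    obtain ⟨_, _, _, _, h₁, h₂, h₃, hs, hb⟩ := h.inv_ite
    exact .sub (.ite (ih h₁) h₂ h₃) hs hb
  | spawn E ih =>
    obtain ⟨_, _, h₁, hs, hb⟩ := h.inv_spawn
    exact .sub (.spawn (ih h₁)) hs hb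
  | branch E I bs ih =>
    obtain ⟨_, _, _, _, h₁, h₂, hs, hb⟩ := h.inv_branch
    exact .sub (.branch (ih h₁) h₂) hs hb

/-- Everything evaluated before the hole is a value with a silent effect, so the effect of the redex
is reached silently. -/
theorem HasTy.fill_head {C : Constraints} {Γ : TyEnv} {r : Expr} (hr : ¬ IsValue r) {E : ECtx}
    {T : Ty} {b : Beh} (h : HasTy C Γ (E.fill r) T b) :
    ∃ U b', HasTy C Γ r U b' ∧ ∀ o, Head C b' o → Head C b o := by
  induction E generalizing T b with
  | hole => exact ⟨_, _, h, fun _ => _root_.id⟩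
  | pairL E e ih =>
    obtain ⟨_, _, _, _, h₁, _, _, hb⟩ := h.inv_pair
    obtain ⟨U, b', h', ho⟩ := ih h₁
    exact ⟨U, b', h', fun o h => hb.head o (.seqLeft (ho o h))⟩
  | pairR v hv E ih =>
    obtain ⟨_, _, _, _, h₁, h₂, _, hb⟩ := h.inv_pair
    obtain ⟨U, b', h', ho⟩ := ih h₂
    exact ⟨U, b', h', fun o h => hb.head o (.seqRight (h₁.value hv).1 (ho o h))⟩
  | appL E e ih =>
    obtain ⟨_, _, _, _, _, h₁, _, _, hb⟩ := h.inv_app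
    obtain ⟨U, b', h', ho⟩ := ih h₁
    exact ⟨U, b', h', fun o h => hb.head o (.seqLeft (.seqLeft (ho o h)))⟩
  | appR v hv E ih =>
    obtain ⟨_, _, _, _, _, h₁, h₂, _, hb⟩ := h.inv_app
    obtain ⟨U, b', h', ho⟩ := ih h₂
    exact ⟨U, b', h', fun o h => hb.head o (.seqLeft (.seqRight (h₁.value hv).1 (ho o h)))⟩
  | letE x E e ih =>
    obtain ⟨S, _, _, _, h₁, _, hS, _, hb⟩ := h.inv_letE
    obtain ⟨U, hU⟩ := hS.resolve_right fun h => E.not_isValue_fill hr h.1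
    obtain ⟨U', b', h', ho⟩ := ih (h₁ U hU)
    exact ⟨U', b', h', fun o h => hb.head o (.seqLeft (ho o h))⟩
  | ite E e₁ e₂ ih =>
    obtain ⟨_, _, _, _, h₁, _, _, _, hb⟩ := h.inv_ite
    obtain ⟨U, b', h', ho⟩ := ih h₁
    exact ⟨U, b', h', fun o h => hb.head o (.seqLeft (ho o h))⟩
  | spawn E ih =>
    obtain ⟨_, _, h₁, _, hb⟩ := h.inv_spawn
    obtain ⟨U, b', h', ho⟩ := ih h₁
    exact ⟨U, b', h', fun o h => hb.head o (.seqLeft (ho o h))⟩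
  | branch E I bs ih =>
    obtain ⟨_, _, _, _, h₁, _, _, hb⟩ := h.inv_branch
    obtain ⟨U, b', h', ho⟩ := ih h₁
    exact ⟨U, b', h', fun o h => hb.head o (.seqLeft (ho o h))⟩

/-! ### Endpoints occurring in expressions and contexts -/

theorem Expr.endps_subst (e v : Expr) (x : ℕ) : (e.subst x v).endps ⊆ e.endps ∪ v.endps := by
  induction e with
  | var y =>
    simp only [Expr.subst]
    split <;> simp [Expr.endps]
  | const k => exact Set.subset_union_left
  | endp p l => exact Set.subset_union_left
  | pair e₁ e₂ ih₁ ih₂ | app e₁ e₂ ih₁ ih₂ =>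
    rintro q (h | h)
    · exact (ih₁ h).imp_left Or.inl
    · exact (ih₂ h).imp_left Or.inr
  | fn y e ih | fix f y e ih =>
    simp only [Expr.subst]
    split
    exacts [Set.subset_union_left, ih]
  | letE y e₁ e₂ ih₁ ih₂ =>
    rintro q (h | h)
    · exact (ih₁ h).imp_left Or.inl
    · split at h
      · exact .inl (.inr h)
      · exact (ih₂ h).imp_left Or.inr
  | ite e₁ e₂ e₃ ih₁ ih₂ ih₃ =>
    rintro q ((h | h) | h)
    · exact (ih₁ h).imp_left fun h => .inl (.inl h)
    · exact (ih₂ h).imp_left fun h => .inl (.inr h)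
    · exact (ih₃ h).imp_left Or.inr
  | spawn e ih => exact ih
  | branch e I bs ih ihs =>
    rintro q (h | h)
    · exact (ih h).imp_left Or.inl
    · obtain ⟨i, h⟩ := Set.mem_iUnion.1 h
      exact (ihs i h).imp_left fun h => .inr (Set.mem_iUnion.2 ⟨i, h⟩)

theorem Beta.endps {e e' : Expr} (h : Beta e e') : e'.endps ⊆ e.endps := by
  cases h with
  | iteTrue e₁ e₂ => exact fun q h => .inl (.inr h)
  | iteFalse e₁ e₂ => exact fun q h => .inr h
  | letE _ => exact (Expr.endps_subst _ _ _).trans fun q h => h.symm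
  | fn _ => exact Expr.endps_subst _ _ _
  | fix _ =>
    refine (Expr.endps_subst _ _ _).trans (Set.union_subset ?_ fun q h => .inl h)
    exact Expr.endps_subst _ _ _

theorem ECtx.endps_fill_mono {r r' : Expr} (h : r'.endps ⊆ r.endps) (E : ECtx) :
    (E.fill r').endps ⊆ (E.fill r).endps := by
  induction E with
  | hole => exact h
  | pairR v hv E ih | appR v hv E ih => exact Set.union_subset_union_right _ ih
  | ite E e₁ e₂ ih => exact Set.union_subset_union_left _ (Set.union_subset_union_left _ ih)
  | spawn E ih => exact ih
  | _ => exact Set.union_subset_union_left _ ‹_›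

theorem ECtx.endps_subset_fill (r : Expr) (E : ECtx) : r.endps ⊆ (E.fill r).endps := by
  induction E with
  | hole => exact subset_rfl
  | pairR v hv E ih | appR v hv E ih => exact ih.trans Set.subset_union_right
  | ite E e₁ e₂ ih => exact ih.trans fun q h => .inl (.inl h)
  | spawn E ih => exact ih
  | _ => exact Set.Subset.trans ‹_› Set.subset_union_left

/-! ### Internal steps preserve types and effects -/

theorem Beta.not_isValue {e e' : Expr} (h : Beta e e') : ¬ IsValue e := by
  intro hv
  cases h <;> cases hv

/-- The effect of the reduct is what remains of the effect of the redex after its silent part; `Le`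
absorbs the difference, with an unfolding in the case of `fix`. -/
theorem HasTy.beta {C : Constraints} (hC : WellFormed C) {e e' : Expr} (h : Beta e e') {T : Ty}
    {b : Beh} (ht : HasTy C (fun _ => ∅) e T b) : HasTy C (fun _ => ∅) e' T b := by
  cases h with
  | iteTrue e₁ e₂ =>
    obtain ⟨_, _, _, _, h₁, h₂, _, hs, hb⟩ := ht.inv_ite
    exact .sub h₂ hs ((Le.plus_left _ _ _).trans
      ((Le.seq_of_fin (h₁.value (.const _)).1 _).trans hb))
  | iteFalse e₁ e₂ =>
    obtain ⟨_, _, _, _, h₁, _, h₃, hs, hb⟩ := ht.inv_ite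
    exact .sub h₃ hs ((Le.plus_right _ _ _).trans
      ((Le.seq_of_fin (h₁.value (.const _)).1 _).trans hb))
  | letE hv =>
    obtain ⟨S, _, b₁, _, h₁, h₂, hS, hs, hb⟩ := ht.inv_letE
    -- If `S` is empty, no derivation speaks about `b₁`, but then the side condition makes it `τ`.
    have hf : Silent C b₁ := by
      rcases hS with ⟨U, hU⟩ | ⟨-, rfl⟩
      exacts [((h₁ U hU).value hv).1, .tau]
    exact .sub (h₂.subst_update hv fun U hU => ((h₁ U hU).value hv).2) hs
      ((Le.seq_of_fin hf _).trans hb)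
  | fn hv =>
    obtain ⟨_, _, _, _, _, h₁, h₂, hs, hb⟩ := ht.inv_app
    obtain ⟨_, _, _, h₃, hs'⟩ := h₁.inv_fn
    obtain ⟨hd, hβ, hc⟩ := hC.typeConsistent _ _ hs'
    have hf := Silent.seq (h₁.value (.fn _ _)).1 (h₂.value hv).1
    refine .sub (h₃.subst_update hv ?_) (hc.trans hs)
      ((Le.of_behSub hβ).trans ((Le.seq_of_fin hf _).trans hb))
    rintro U rfl
    exact .sub (h₂.value hv).2 hd (.refl _ _)
  | fix hv =>
    obtain ⟨_, _, _, _, _, h₁, h₂, hs, hb⟩ := ht.inv_app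
    obtain ⟨_, _, _, _, h₃, hr, hs'⟩ := h₁.inv_fix
    obtain ⟨hd, hβ, hc⟩ := hC.typeConsistent _ _ hs'
    have hf := Silent.seq (h₁.value (.fix _ _ _)).1 (h₂.value hv).1
    -- The argument goes first because `x` is the inner binder, the last update of the environment.
    refine .sub (HasTy.subst_update (h₃.subst_update hv ?_) (.fix _ _ _) ?_) (hc.trans hs)
      ((Le.of_unfold (hr.trans hβ)).trans ((Le.seq_of_fin hf _).trans hb))
    · rintro U rfl
      exact .sub (h₂.value hv).2 hd (.refl _ _)
    · rintro U rfl
      exact .fix h₃ hr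

theorem HasTy.unit (C : Constraints) (Γ : TyEnv) : HasTy C Γ .unit .unit .tau :=
  .const (Subst.ofSes Sess.var) .unit fun _ hc => absurd hc List.not_mem_nil

theorem HasTy.spawn_unit {C : Constraints} {Γ : TyEnv} {v : Expr} {T : Ty} {b : Beh}
    (hv : IsValue v) (h : HasTy C Γ (.spawn v) T b) : HasTy C Γ .unit T b := by
  obtain ⟨_, _, h₁, hs, hb⟩ := h.inv_spawn
  exact .sub (.unit C Γ) hs
    ((Le.tau_of_fin (.seq (h₁.value hv).1 (.spawn _))).trans hb)

/-- The behaviour of the new process is spawned at a head of the parent's effect, so the safety of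
the parent excludes session operations in it. -/
theorem HasTy.spawned {C : Constraints} {Γ : TyEnv} {v : Expr} {E : ECtx} {T : Ty} {b : Beh}
    (hv : IsValue v) (h : HasTy C Γ (E.fill (.spawn v)) T b) :
    ∃ b', Head C b (.spawn b') ∧ HasTy C Γ (.app v .unit) .unit b' := by
  obtain ⟨_, _, h, ho⟩ := h.fill_head (r := .spawn v) nofun
  obtain ⟨β, _, h₁, -, hb⟩ := h.inv_spawn
  obtain ⟨hf, h₂⟩ := h₁.value hv
  exact ⟨.var β, ho _ (hb.head _ (.seqRight hf (.spawn _))),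
    .sub (.app h₂ (.unit C Γ)) (.refl _)
      (((Le.seq_tau_left C .tau).seq_left _).trans (.seq_tau_left C _))⟩

/-! ### The invariant of running systems -/

/-- The expression of a process has its behaviour, which agrees with its stack, and the endpoints
in the expression agree with the stack. -/
structure Proc.Ok (C : Constraints) (P : Proc) : Prop where
  typed : ∃ T, HasTy C (fun _ => ∅) P.expr T P.beh
  safe : Safe C P.stack.frames P.beh
  annot : ∀ f ∈ P.frames, ∀ q : Endpoint, (q, f.label) ∈ P.expr.endps → q = f.endpoint

/-- Well-stackedness of a multiset of stacks, without freshness of the endpoints. -/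
inductive Stacked (C : Constraints) : Multiset (List Frame) → Prop
  | nil {M} : (∀ fs ∈ M, fs = []) → Stacked C M
  | pair {M fs fs'} {p : Endpoint} {l l' η η'} : Stacked C (fs ::ₘ fs' ::ₘ M) → Dual C η η' →
      Stacked C ((⟨p, l, η⟩ :: fs) ::ₘ (⟨p.bar, l', η'⟩ :: fs') ::ₘ M)

theorem WellStacked.stacked {C : Constraints} {S : Config} (h : WellStacked C S) :
    Stacked C (S.map Proc.frames) := by
  induction h with
  | nil h => exact .nil (by simpa using h)
  | pair _ hd _ ih =>
    simp only [Multiset.map_cons] at ih ⊢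
    exact .pair ih hd

/-- A spawned process joins the system with an empty stack. -/
theorem Stacked.cons_nil {C : Constraints} {M : Multiset (List Frame)} (h : Stacked C M) :
    Stacked C ([] ::ₘ M) := by
  induction h with
  | nil h => exact .nil (by simpa using h)
  | @pair M fs fs' p l l' η η' _ hd ih =>
    have key : ∀ a b : List Frame, [] ::ₘ a ::ₘ b ::ₘ M = a ::ₘ b ::ₘ [] ::ₘ M := fun a b => by
      rw [Multiset.cons_swap, Multiset.cons_swap [] b]
    rw [key] at ih ⊢
    exact .pair ih hd

theorem exists_cons_of_map_eq_cons {α β : Type*} {f : α → β} {s : Multiset α} {b : β}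
    {t : Multiset β} (h : s.map f = b ::ₘ t) :
    ∃ a s', s = a ::ₘ s' ∧ f a = b ∧ s'.map f = t := by
  obtain ⟨a, ha, rfl⟩ := Multiset.mem_map.1 (h ▸ Multiset.mem_cons_self b t)
  obtain ⟨s', rfl⟩ := Multiset.exists_cons_of_mem ha
  rw [Multiset.map_cons, Multiset.cons_inj_right] at h
  exact ⟨a, s', rfl, rfl, h⟩

/-- A running system of suitably typed processes with matching stacks. -/
structure Config.Ok (C : Constraints) (S : Config) : Prop where
  procs : ∀ P ∈ S, P.Ok C
  stacked : Stacked C (S.map Proc.frames)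

theorem Proc.Ok.set_expr {C : Constraints} {P : Proc} (h : P.Ok C) {e : Expr}
    (he : ∀ T b, HasTy C (fun _ => ∅) P.expr T b → HasTy C (fun _ => ∅) e T b)
    (hq : e.endps ⊆ P.expr.endps) : ({ P with expr := e } : Proc).Ok C :=
  ⟨h.typed.imp fun _ => he _ _, h.safe, fun f hf q hm => h.annot f hf q (hq hm)⟩

/-- Existing processes keep their stacks and behaviours, and their endpoints can only disappear. A
spawned process receives the empty stack, which is safe as its behaviour has no hits. -/
theorem Config.Ok.intStep {C : Constraints} (hC : WellFormed C) {S : Config} (h : S.Ok C)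
    {Y : System} (hs : System.IntStep S.erase Y) : ∃ S₁ : Config, S₁.erase = Y ∧ S₁.Ok C := by
  generalize hX : S.erase = X at hs
  cases hs with
  | beta E M hb =>
    obtain ⟨P, S', rfl, hP, rfl⟩ := exists_cons_of_map_eq_cons hX
    refine ⟨{ P with expr := _ } ::ₘ S', Multiset.map_cons _ _ _, ?_, ?_⟩
    · intro Q hQ
      rcases Multiset.mem_cons.1 hQ with rfl | hQ
      · refine (h.procs P (Multiset.mem_cons_self _ _)).set_expr (fun T b ht => ?_) ?_ <;>
          rw [hP] at *
        · exact ht.fill_congr hb.not_isValue fun _ _ => HasTy.beta hC hb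
        · exact E.endps_fill_mono hb.endps
      · exact h.procs Q (Multiset.mem_cons_of_mem hQ)
    · simpa using h.stacked
  | @spawn E v M hv =>
    obtain ⟨P, S', rfl, hP, rfl⟩ := exists_cons_of_map_eq_cons hX
    have hOk := h.procs P (Multiset.mem_cons_self _ _)
    obtain ⟨T, ht⟩ := hOk.typed
    rw [hP] at ht
    obtain ⟨b', ho, ht'⟩ := ht.spawned hv
    refine ⟨{ P with expr := E.fill .unit } ::ₘ ⟨[], ∅, b', .app v .unit⟩ ::ₘ S', ?_, ?_, ?_⟩
    · simp only [Config.erase, Multiset.map_cons]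
    · intro Q hQ
      rcases Multiset.mem_cons.1 hQ with rfl | hQ
      · refine hOk.set_expr (fun T b ht => ?_) ?_ <;> rw [hP] at *
        · exact ht.fill_congr (r := .spawn v) nofun fun _ _ => HasTy.spawn_unit hv
        · exact E.endps_fill_mono (Set.empty_subset _)
      rcases Multiset.mem_cons.1 hQ with rfl | hQ
      · exact ⟨⟨_, ht'⟩, .of_not_hit (hOk.safe.spawn b' ho), nofun⟩
      · exact h.procs Q (Multiset.mem_cons_of_mem hQ)
    · have := h.stacked.cons_nil
      simp only [Multiset.map_cons] at this ⊢
      rwa [Multiset.cons_swap]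

/-- Steps of running systems constrain only the expressions, so the invariant is claimed for a
system with the expressions of `S'` and annotations of its own. -/
theorem Config.Ok.intSteps {C : Constraints} (hC : WellFormed C) {S S' : Config} (h : S.Ok C)
    (hs : S.IntSteps S') : ∃ S₁ : Config, S₁.erase = S'.erase ∧ S₁.Ok C := by
  induction hs with
  | refl => exact ⟨S, rfl, h⟩
  | tail _ hs ih =>
    obtain ⟨S₁, he, h₁⟩ := ih
    exact h₁.intStep hC (he ▸ hs)

theorem Config.Ok.of_wellTyped {C : Constraints} {S : Config} (ht : WellTyped C S)
    (hs : WellStacked C S) (ha : WellAnnotated S) : S.Ok C where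
  procs P hP := by
    obtain ⟨⟨T, h⟩, hn⟩ := ht.2.2 P hP
    exact ⟨⟨T, h.hasTy_closed⟩, .of_normalizes ht.1.compact hn, ha P hP⟩
  stacked := hs.stacked

/-! ### Blocked processes -/

/-- The expression is about to perform the first operation of `η` on the endpoint `p`. -/
def Ready (p : Endpoint) (η : Sess) (e : Expr) : Prop :=
  match η with
  | .out _ _ => ∃ (E : ECtx) (l : ℕ) (v : Expr), IsValue v ∧
      e = E.fill (.app (.const .send) (.pair (.endp p l) v))
  | .inp _ _ => ∃ (E : ECtx) (l : ℕ), e = E.fill (.app (.const .recv) (.endp p l))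
  | .del _ _ => ∃ (E : ECtx) (l l' : ℕ) (q : Endpoint),
      e = E.fill (.app (.const .deleg) (.pair (.endp p l) (.endp q l')))
  | .res _ _ => ∃ (E : ECtx) (l l' : ℕ), e = E.fill (.app (.const (.resume l')) (.endp p l))
  | .ich I _ => ∃ (E : ECtx) (l : ℕ), ∃ j ∈ I,
      e = E.fill (.app (.const (.select j)) (.endp p l))
  | .ech I₁ _ _ _ _ => ∃ (E : ECtx) (l : ℕ) (J : Finset ℕ) (bs : {i // i ∈ J} → Expr),
      I₁ ⊆ J ∧ e = E.fill (.branch (.endp p l) J bs)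
  | _ => False

theorem SessionRedex.not_isValue {r : Expr} (h : SessionRedex r) : ¬ IsValue r := by
  intro hv
  cases h <;> cases hv

theorem RegEq.lab_unique {C : Constraints} (hC : WellFormed C) {ρ l l' : ℕ}
    (h : RegEq C (.var ρ) (.lab l)) (h' : RegEq C (.var ρ) (.lab l')) : l = l' :=
  hC.regionConsistent _ _ (.trans _ _ _ (.symm _ _ h) h')

/-- Both the constant and its argument are silent, so the heads of the latent effect are heads of
the whole application. -/
theorem HasTy.inv_const_app {C : Constraints} (hC : WellFormed C) {k : Const} {v : Expr}
    {T : Ty} {b : Beh} (hv : IsValue v) (h : HasTy C (fun _ => ∅) (.app (.const k) v) T b)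
    {U U' : Ty} {β : ℕ} (hk : k.typeOf.body = .fn U β U') :
    ∃ σ, Sat C σ k.typeOf.constr ∧ HasTy C (fun _ => ∅) v (U.subst σ) .tau ∧
      ∀ o, Head C (.var (σ.beh β)) o → Head C b o := by
  obtain ⟨_, _, _, _, _, h₁, h₂, -, hb⟩ := h.inv_app
  obtain ⟨σ, hσ, hs⟩ := h₁.inv_const
  rw [hk] at hs
  obtain ⟨hd, hβ, -⟩ := hC.typeConsistent _ _ hs
  exact ⟨σ, hσ, .sub (h₂.value hv).2 hd (.refl _ _), fun o ho => hb.head o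
    (.seqRight (.seq (h₁.value (.const k)).1 (h₂.value hv).1) (.beta hβ ho))⟩

/-- The operation of the redex is a head of `b`, so safety grants it a transition, and its rule
dictates the shape of the top frame. The argument is an endpoint by canonical forms. -/
theorem HasTy.ready {C : Constraints} (hC : WellFormed C) {E : ECtx} {r : Expr} {T : Ty} {b : Beh}
    {fs : List (ℕ × Sess)} (hr : SessionRedex r) (h : HasTy C (fun _ => ∅) (E.fill r) T b)
    (hs : Safe C fs b) :
    ∃ l η gs p, stripDone fs = (l, η) :: gs ∧ (p, l) ∈ (E.fill r).endps ∧
      Ready p η (E.fill r) := by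
  obtain ⟨U, b', h', ho⟩ := h.fill_head hr.not_isValue
  have hop : ∀ o, Head C b' o → o.IsSessionOp → _ := fun o h => hs.op o (ho o h)
  have mem : ∀ q, q ∈ r.endps → q ∈ (E.fill r).endps := E.endps_subset_fill r
  clear hs ho h
  have htop := stripDone_topOpen fs
  generalize stripDone fs = fs' at hop htop ⊢
  cases hr with
  | send hv =>
    obtain ⟨σ, hσ, hv', ho⟩ := h'.inv_const_app hC hv rfl
    obtain ⟨v₁, v₂, rfl, hv₁, hv₂, h₁, h₂⟩ := hv'.canonical_pair hC hv
    obtain ⟨p, l, rfl, hl⟩ := h₁.canonical_ses hC hv₁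
    have hb : BehSub C (.out (σ.reg 0) (σ.ty 0)) (.var (σ.beh 0)) :=
      hσ (.behSub (.out 0 (.var 0)) 0) (by simp [Const.typeOf])
    -- The region of the operation is equated with both the label of the endpoint and that of the
    -- top frame, so these labels coincide. The other operations are treated alike.
    obtain ⟨R, u, conf, hs⟩ := hop _ (ho _ (.beta hb (.op trivial))) trivial
    cases hs with
    | fin => exact absurd rfl (htop _ _)
    | out hl' _ =>
      obtain rfl := RegEq.lab_unique hC hl hl'
      exact ⟨_, _, _, p, rfl, mem _ (by simp [Expr.endps]), E, _, v₂, hv₂, rfl⟩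
  | recv hv =>
    obtain ⟨σ, hσ, hv', ho⟩ := h'.inv_const_app hC hv rfl
    obtain ⟨p, l, rfl, hl⟩ := hv'.canonical_ses hC hv
    have hb : BehSub C (.inp (σ.reg 0) (σ.ty 0)) (.var (σ.beh 0)) :=
      hσ (.behSub (.inp 0 (.var 0)) 0) (by simp [Const.typeOf])
    obtain ⟨R, u, conf, hs⟩ := hop _ (ho _ (.beta hb (.op trivial))) trivial
    cases hs with
    | fin => exact absurd rfl (htop _ _)
    | inp hl' _ =>
      obtain rfl := RegEq.lab_unique hC hl hl'
      exact ⟨_, _, _, p, rfl, mem _ (by simp [Expr.endps]), E, _, rfl⟩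
  | deleg hv =>
    obtain ⟨σ, hσ, hv', ho⟩ := h'.inv_const_app hC hv rfl
    obtain ⟨v₁, v₂, rfl, hv₁, hv₂, h₁, h₂⟩ := hv'.canonical_pair hC hv
    obtain ⟨p, l, rfl, hl⟩ := h₁.canonical_ses hC hv₁
    obtain ⟨q, l', rfl, -⟩ := h₂.canonical_ses hC hv₂
    have hb : BehSub C (.del (σ.reg 0) (σ.reg 1)) (.var (σ.beh 0)) :=
      hσ (.behSub (.del 0 1) 0) (by simp [Const.typeOf])
    obtain ⟨R, u, conf, hs⟩ := hop _ (ho _ (.beta hb (.op trivial))) trivial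
    cases hs with
    | fin => exact absurd rfl (htop _ _)
    | del hl' _ _ =>
      obtain rfl := RegEq.lab_unique hC hl hl'
      exact ⟨_, _, _, p, rfl, mem _ (by simp [Expr.endps]), E, _, _, _, rfl⟩
  | @resume k v hv =>
    obtain ⟨σ, hσ, hv', ho⟩ := h'.inv_const_app hC hv rfl
    obtain ⟨p, l, rfl, hl⟩ := hv'.canonical_ses hC hv
    have hb : BehSub C (.res (σ.reg 0) k) (.var (σ.beh 0)) :=
      hσ (.behSub (.res 0 k) 0) (by simp [Const.typeOf])
    obtain ⟨R, u, conf, hs⟩ := hop _ (ho _ (.beta hb (.op trivial))) trivial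
    cases hs with
    | fin => exact absurd rfl (htop _ _)
    | res _ hl' =>
      obtain rfl := RegEq.lab_unique hC hl hl'
      exact ⟨_, _, _, p, rfl, mem _ (by simp [Expr.endps]), E, _, _, rfl⟩
  | @select i v hv =>
    obtain ⟨σ, hσ, hv', ho⟩ := h'.inv_const_app hC hv rfl
    obtain ⟨p, l, rfl, hl⟩ := hv'.canonical_ses hC hv
    have hb : BehSub C (.sel (σ.reg 0) i) (.var (σ.beh 0)) :=
      hσ (.behSub (.sel 0 i) 0) (by simp [Const.typeOf])
    obtain ⟨R, u, conf, hs⟩ := hop _ (ho _ (.beta hb (.op trivial))) trivial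
    cases hs with
    | fin => exact absurd rfl (htop _ _)
    | ich j hl' =>
      obtain rfl := RegEq.lab_unique hC hl hl'
      exact ⟨_, _, _, p, rfl, mem _ (by simp [Expr.endps]), E, _, j.1, j.2, rfl⟩
  | branch hv =>
    obtain ⟨ρ, _, _, bs, h₁, -, -, hb⟩ := h'.inv_branch
    obtain ⟨p, l, rfl, hl⟩ := h₁.canonical_ses hC hv
    obtain ⟨R, u, conf, hs⟩ :=
      hop _ (hb.head _ (.seqRight (h₁.value hv).1 (.op trivial))) trivial
    cases hs with
    | fin => exact absurd rfl (htop _ _)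
    | ech k hk hk' hl' hI _ =>
      obtain rfl := RegEq.lab_unique hC hl hl'
      exact ⟨_, _, _, p, rfl, mem _ (by simp [Expr.endps]), E, _, _, _, hI, rfl⟩

/-! ### Progress -/

theorem Proc.Ok.ready {C : Constraints} (hC : WellFormed C) {P : Proc} (h : P.Ok C)
    (hb : P.Blocked) : ∃ l η gs p, stripDone P.stack.frames = (l, η) :: gs ∧
      (p, l) ∈ P.expr.endps ∧ Ready p η P.expr := by
  obtain ⟨E, r, he, hr⟩ := hb
  obtain ⟨T, ht⟩ := h.typed
  rw [he] at ht ⊢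
  exact ht.ready hC hr h.safe

/-- A value has a silent effect, which would require an empty stack. A blocked process acts on an
endpoint with the label of the top frame, and the annotations identify that endpoint as `p`. -/
theorem Proc.Ok.ready_top {C : Constraints} (hC : WellFormed C) {P : Proc} (h : P.Ok C)
    (hb : IsValue P.expr ∨ P.Blocked) {p : Endpoint} {l : ℕ} {η : Sess} {fs : List Frame}
    (hf : P.frames = ⟨p, l, η⟩ :: fs) (hη : η ≠ .done) : Ready p η P.expr := by
  have hs : stripDone P.stack.frames = (l, η) :: fs.map (fun f => (f.label, f.sess)) := by
    simp only [Proc.stack, hf, List.map_cons]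
    cases η <;> first | rfl | exact absurd rfl hη
  rcases hb with hv | hb
  · obtain ⟨T, ht⟩ := h.typed
    have hn := h.safe.fin (ht.value hv).1
    rw [hs] at hn
    cases hn
  · obtain ⟨l', η', gs, q, hs', hm, hr⟩ := h.ready hC hb
    rw [hs] at hs'
    cases hs'
    obtain rfl := h.annot ⟨p, l, η⟩ (by simp [hf]) q hm
    exact hr

/-- Safety depends on the frames only through `stripDone`. -/
theorem Proc.Ok.pop {C : Constraints} {P : Proc} (h : P.Ok C) {p : Endpoint} {l : ℕ}
    {fs : List Frame} (hf : P.frames = ⟨p, l, .done⟩ :: fs) :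
    ({ P with frames := fs } : Proc).Ok C where
  typed := h.typed
  safe := by
    have hs : stripDone P.stack.frames = stripDone (fs.map fun f => (f.label, f.sess)) := by
      simp [Proc.stack, hf, stripDone]
    obtain ⟨h₁, h₂, h₃⟩ := h.safe
    rw [hs] at h₁ h₃
    exact ⟨h₁, h₂, h₃⟩
  annot f hm := h.annot f (hf ▸ List.mem_cons_of_mem _ hm)

theorem Dual.done_iff {C : Constraints} {η η' : Sess} (h : Dual C η η') :
    η = .done ↔ η' = .done := by
  cases h <;> simp

theorem Endpoint.bar_bar (p : Endpoint) : p.bar.bar = p := by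
  simp [Endpoint.bar]

/-- Duality pairs each first operation with its counterpart. When `p` is the receiving side, the
roles are swapped and `p` is read as the dual of `p.bar`. -/
theorem Ready.comStep {C : Constraints} {η η' : Sess} (hd : Dual C η η') (hη : η ≠ .done)
    {p : Endpoint} {e e' : Expr} (h : Ready p η e) (h' : Ready p.bar η' e') (M : System) :
    ∃ Y, System.ComStep (e ::ₘ e' ::ₘ M) Y := by
  cases hd with
  | done => exact absurd rfl hη
  | outInp _ _ =>
    obtain ⟨E, l, v, hv, rfl⟩ := h
    obtain ⟨E', l', rfl⟩ := h'
    exact ⟨_, .comm E E' l l' p M hv⟩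
  | inpOut _ _ =>
    rw [← p.bar_bar] at h
    obtain ⟨E, l, rfl⟩ := h
    obtain ⟨E', l', v, hv, rfl⟩ := h'
    rw [Multiset.cons_swap]
    exact ⟨_, .comm E' E l' l p.bar M hv⟩
  | delRes _ _ =>
    obtain ⟨E, l, k, q, rfl⟩ := h
    obtain ⟨E', l', k', rfl⟩ := h'
    exact ⟨_, .deleg E E' l k l' k' p q M⟩
  | resDel _ _ =>
    rw [← p.bar_bar] at h
    obtain ⟨E, l, k, rfl⟩ := h
    obtain ⟨E', l', k', q, rfl⟩ := h'
    rw [Multiset.cons_swap]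
    exact ⟨_, .deleg E' E l' k' l k p.bar q M⟩
  | ichEch hI _ =>
    obtain ⟨E, l, j, hj, rfl⟩ := h
    obtain ⟨E', l', J, bs, hJ, rfl⟩ := h'
    -- The selected label is active in the dual choice, and every active label is offered by the
    -- `match`.
    exact ⟨_, .select E E' l l' p J bs ⟨j, hJ (hI hj)⟩ M⟩
  | echIch hI _ =>
    rw [← p.bar_bar] at h
    obtain ⟨E, l, J, bs, hJ, rfl⟩ := h
    obtain ⟨E', l', j, hj, rfl⟩ := h'
    rw [Multiset.cons_swap]
    exact ⟨_, .select E' E l' l p.bar J bs ⟨j, hJ (hI hj)⟩ M⟩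

/-- Induction on the matching of the stacks: an unfinished pair on top would communicate, finished
pairs are removed, and with empty stacks no process can be blocked. -/
theorem Stacked.isValue {C : Constraints} (hC : WellFormed C) {M : Multiset (List Frame)}
    (h : Stacked C M) {S : Config} (hM : S.map Proc.frames = M) (hS : ∀ P ∈ S, P.Ok C)
    (hb : ∀ P ∈ S, IsValue P.expr ∨ P.Blocked) (hcom : ¬ ∃ Y, System.ComStep S.erase Y) :
    ∀ P ∈ S, IsValue P.expr := by
  induction h generalizing S with
  | nil hM' =>
    intro P hP
    refine (hb P hP).resolve_right fun hbl => ?_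
    obtain ⟨_, _, _, _, hs, -⟩ := (hS P hP).ready hC hbl
    have hf : P.frames = [] := hM' _ (hM ▸ Multiset.mem_map_of_mem _ hP)
    simp [Proc.stack, hf, stripDone] at hs
  | @pair M fs fs' p l l' η η' _ hd ih =>
    obtain ⟨P, S₁, rfl, hP, hM₁⟩ := exists_cons_of_map_eq_cons hM
    obtain ⟨P', S₂, rfl, hP', rfl⟩ := exists_cons_of_map_eq_cons hM₁
    have memP : P ∈ P ::ₘ P' ::ₘ S₂ := by simp
    have memP' : P' ∈ P ::ₘ P' ::ₘ S₂ := by simp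
    by_cases hη : η = .done
    · have hη' := hd.done_iff.1 hη
      subst hη hη'
      -- Removing the finished pair leaves all expressions unchanged, so blockedness and the absence
      -- of communication carry over.
      have := ih (S := { P with frames := fs } ::ₘ { P' with frames := fs' } ::ₘ S₂) (by simp)
        (by
          simp only [Multiset.mem_cons, forall_eq_or_imp] at hS ⊢
          exact ⟨hS.1.pop hP, hS.2.1.pop hP', hS.2.2⟩)
        (by
          simp only [Multiset.mem_cons, forall_eq_or_imp] at hb ⊢
          exact hb)
        (by simpa [Config.erase] using hcom)
      simp only [Multiset.mem_cons, forall_eq_or_imp] at this ⊢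
      exact this
    · refine absurd ?_ hcom
      simp only [Config.erase, Multiset.map_cons]
      exact Ready.comStep hd hη ((hS P memP).ready_top hC (hb P memP) hP hη)
        ((hS P' memP').ready_top hC (hb P' memP') hP' fun h => hη (hd.done_iff.2 h)) _

theorem Proc.Blocked.not_isValue {P : Proc} (h : P.Blocked) : ¬ IsValue P.expr := by
  obtain ⟨E, r, he, hr⟩ := h
  rw [he]
  exact E.not_isValue_fill hr.not_isValue

theorem Config.exists_erase_eq (X : System) : ∃ S : Config, S.erase = X :=
  ⟨X.map fun e => ⟨[], ∅, .tau, e⟩, by simp [Config.erase]⟩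

end MLS

/-! ### Partial lock freedom -/

theorem mainTheorem3 (C : MLS.Constraints) (S : MLS.Config)
    (htyped : MLS.WellTyped C S) (hstacked : MLS.WellStacked C S)
    (hannot : MLS.WellAnnotated S)
    (hcom : ¬ ∃ S' : MLS.Config, S.WeakComStep S')
    (S' F B : MLS.Config) (hint : S.IntSteps S') (hsplit : S'.Splits F 0 0 B) :
    B = 0 := by
  obtain ⟨rfl, hF, -, -, hB⟩ := hsplit
  rw [add_zero, add_zero] at hint
  have hC := htyped.1
  obtain ⟨S₁, he, h₁⟩ := (MLS.Config.Ok.of_wellTyped htyped hstacked hannot).intSteps hC hint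
  -- `S₁` and `F + B` share only their expressions; being a value or blocked depends on nothing
  -- else.
  have lift : ∀ P ∈ S₁, ∃ Q ∈ F + B, Q.expr = P.expr := fun P hP =>
    Multiset.mem_map.1 (show P.expr ∈ MLS.Config.erase (F + B) from
      he ▸ Multiset.mem_map_of_mem MLS.Proc.expr hP)
  have hvals : ∀ P ∈ S₁, MLS.IsValue P.expr := by
    refine h₁.stacked.isValue hC rfl h₁.procs (fun P hP => ?_) ?_
    · obtain ⟨Q, hQ, hPQ⟩ := lift P hP
      rcases Multiset.mem_add.1 hQ with hQ | hQ
      · exact .inl (hPQ ▸ (hF Q hQ).2.2)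
      · obtain ⟨E, r, hE, hr⟩ := hB Q hQ
        exact .inr ⟨E, r, hPQ ▸ hE, hr⟩
    · rintro ⟨Y, hY⟩
      -- Any annotation of `Y` will do, as communication steps of running systems look only at the
      -- expressions.
      obtain ⟨S₂, rfl⟩ := MLS.Config.exists_erase_eq Y
      exact hcom ⟨S₂, _, S₂, hint, show MLS.System.ComStep _ _ from he ▸ hY, .refl⟩
  refine Multiset.eq_zero_of_forall_notMem fun P hP => (hB P hP).not_isValue ?_
  have hmem : P.expr ∈ S₁.erase := by
    rw [he]
    exact Multiset.mem_map_of_mem MLS.Proc.expr (Multiset.mem_add.2 (.inr hP))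
  obtain ⟨Q, hQ, hPQ⟩ := Multiset.mem_map.1 hmem
  exact hPQ ▸ hvals Q hQ
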